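/- Let $G$ be a (real, finite-dimensional) Lie group with Lie algebra $\mathfrak g=T_eG$, $H\subset G$ a closed subgroup with Lie algebra $\mathfrak h$, $\pi:G\to G/H$ the projection onto the smooth coset space (with its unique smooth structure for which $\pi$ is a smooth submersion), $o=\pi(e)$, and $\mathfrak g=\mathfrak h+\mathfrak m$ a direct sum decomposition into linear subspaces (not necessarily reductive). For $v\in\mathfrak g$ let $v_{\mathfrak m}$ be its $\mathfrak m$-component and $[\cdot,\cdot]_{\mathfrak m}=([\cdot,\cdot])_{\mathfrak m}$; identify $\mathfrak m$ with $T_o(G/H)$ through $\pi_*$. A spray structure on a manifold $M$ is a smooth vector field $\mathbf G$ on $TM\setminus 0$ which in all standard local coordinates $(x^i,y^j)$ has the form $\mathbf G=y^i\partial_{x^i}-2\mathbf G^i(x,y)\partial_{y^i}$ with $\mathbf G^i(x,\lambda y)=\lambda^2\mathbf G^i(x,y)$ for $\lambda>0$. A geodesic is a smooth curve $c$ with nowhere vanishing $\dot c$ such that $(c,\dot c)$ is an integral curve of $\mathbf G$. For a smooth vector field $W=W^i\partial_{x^i}$ along a smooth curve $c$ with nowhere vanishing $\dot c$, put $$D_{\dot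 c(t)}W(t)=\Big(\tfrac{d}{dt}W^i(t)+\tfrac{\partial \mathbf G^i}{\partial y^j}(c(t),\dot c(t))\,W^j(t)\Big)\partial_{x^i}|_{c(t)};$$ $W$ is linearly parallel along $c$ if $D_{\dot c(t)}W(t)=0$ for all $t$. Let $\mathbf G$ be a $G$-invariant spray structure on $G/H$. A lift of a smooth curve $c$ in $G/H$ with $c(0)=o$ and nowhere vanishing $\dot c$ is a smooth curve $\bar c$ in $G$ with $\bar c(0)=e$, $c(t)=\bar c(t)\cdot o$ and $y(t):=(L_{\bar c(t)^{-1}})_*(\dot{\bar c}(t))\in\mathfrak m\setminus\{0\}$ for all $t$. For $y\in\mathfrak m\setminus\{0\}$ the spray vector field is $\eta(y)=-\tfrac{d}{dt}|_{t=0}\,y(t)\in\mathfrak m$, where $y(t)$ comes from the lift (near $t=0$) of the geodesic $c$ with $c(0)=o$, $\dot c(0)=y$; the connection operator is $N(y,w)=\tfrac12\tfrac{d}{ds}|_{s=0}\eta(y+sw)-\tfrac12[y,w]_{\mathfrak m}$ for $y\in\mathfrak m\setminus\{0\}$, $w\in\mathfrak m$. **Theorem.** Let $c$ be a smooth curve in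 $G/H$, defined on an open interval containing $0$, with $c(0)=o$ and nowhere vanishing $\dot c$, let $\bar c$ be a lift of $c$ on the same interval, and $y(t)=(L_{\bar c(t)^{-1}})_*(\dot{\bar c}(t))\in\mathfrak m\setminus\{0\}$. Let $W$ be a smooth vector field along $c$, written as $W(t)=\bar c(t)_*(w(t))$ with $w(t)\in\mathfrak m$, where $\bar c(t)_*$ denotes the differential at $o$ of the action of $\bar c(t)$ on $G/H$. Then $w$ is differentiable and, for all $t$, $$D_{\dot c(t)}W(t)=\bar c(t)_*\Big(\tfrac{d}{dt}w(t)+N(y(t),w(t))+[y(t),w(t)]_{\mathfrak m}\Big).$$ In particular, $W$ is linearly parallel along $c$ if and only if $\tfrac{d}{dt}w(t)+N(y(t),w(t))+[y(t),w(t)]_{\mathfrak m}=0$ for all $t$. -/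

import Mathlib

open Set Bundle Manifold
open scoped Manifold ContDiff Topology

noncomputable section

namespace SprayGeometry

/-! ### Curves in manifolds, and standard local coordinates of the tangent bundle -/

section Manifold

variable {F : Type*} [NormedAddCommGroup F] [NormedSpace ℝ F]
  {M : Type*} [TopologicalSpace M] [ChartedSpace F M]

/-- The velocity `ċ(t)` of a curve `c` in a manifold `M`. -/
def velocity (c : ℝ → M) (t : ℝ) : TangentSpace 𝓘(ℝ, F) (c t) :=
  mfderiv 𝓘(ℝ, ℝ) 𝓘(ℝ, F) c t (1 : ℝ)

variable (F) in
/-- The canonical lift `t ↦ (c(t), ċ(t))` of a curve to the tangent bundle. -/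
def velocityLift (c : ℝ → M) (t : ℝ) : TangentBundle 𝓘(ℝ, F) M :=
  ⟨c t, velocity c t⟩

/-- The standard local coordinates `(x, y) = (xⁱ, yʲ)` on the tangent bundle induced by a chart `e`
of `M`: the tangent vector `yʲ ∂_{xʲ}` at the point with coordinates `x` is sent to `(x, y)`. -/
def tangentCoord (e : OpenPartialHomeomorph M F) (p : TangentBundle 𝓘(ℝ, F) M) : F × F :=
  (e p.proj, mfderiv 𝓘(ℝ, F) 𝓘(ℝ, F) e p.proj p.snd)

/-- The tangent vector with given standard local coordinates `q = (x, y)`. -/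
def tangentOfCoord (e : OpenPartialHomeomorph M F) (q : F × F) : TangentBundle 𝓘(ℝ, F) M :=
  ⟨e.symm q.1, mfderiv 𝓘(ℝ, F) 𝓘(ℝ, F) e.symm q.1 q.2⟩

/-- The slit tangent bundle `TM \ 0`. -/
def slitTangentBundle (F M : Type*) [NormedAddCommGroup F] [NormedSpace ℝ F]
    [TopologicalSpace M] [ChartedSpace F M] : Set (TangentBundle 𝓘(ℝ, F) M) :=
  {p | p.snd ≠ 0}

variable [IsManifold 𝓘(ℝ, F) ∞ M]

/-- The components `(a, b)` of a vector field `X = aⁱ ∂_{xⁱ} + bʲ ∂_{yʲ}` on the tangent bundle, in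
the standard local coordinates induced by the chart `e`, at the point with coordinates `q`. -/
def vectorFieldCoord
    (X : (p : TangentBundle 𝓘(ℝ, F) M) → TangentSpace 𝓘(ℝ, F).tangent p)
    (e : OpenPartialHomeomorph M F) (q : F × F) : F × F :=
  mfderiv 𝓘(ℝ, F).tangent 𝓘(ℝ, F × F) (tangentCoord e) (tangentOfCoord e q)
    (X (tangentOfCoord e q))

end Manifold

/-! ### Sprays -/

/-- A spray structure on `M`: a smooth vector field on the slit tangent bundle which in all standard
local coordinates has the form `yⁱ ∂_{xⁱ} - 2 Gⁱ(x, y) ∂_{yⁱ}` with `Gⁱ` positively 2-homogeneous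
in `y`. The values of `toFun` at zero vectors are irrelevant. -/
structure Spray (F M : Type*) [NormedAddCommGroup F] [NormedSpace ℝ F]
    [TopologicalSpace M] [ChartedSpace F M] [IsManifold 𝓘(ℝ, F) ∞ M] where
  toFun : (p : TangentBundle 𝓘(ℝ, F) M) → TangentSpace 𝓘(ℝ, F).tangent p
  contMDiffOn_toFun : ContMDiffOn 𝓘(ℝ, F).tangent 𝓘(ℝ, F).tangent.tangent ∞
    (fun p ↦ (⟨p, toFun p⟩ : TangentBundle 𝓘(ℝ, F).tangent (TangentBundle 𝓘(ℝ, F) M)))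
    (slitTangentBundle F M)
  coord_fst : ∀ e ∈ IsManifold.maximalAtlas 𝓘(ℝ, F) ∞ M, ∀ x ∈ e.target, ∀ y : F, y ≠ 0 →
    (vectorFieldCoord toFun e (x, y)).1 = y
  coord_snd_homogeneous : ∀ e ∈ IsManifold.maximalAtlas 𝓘(ℝ, F) ∞ M,
    ∀ x ∈ e.target, ∀ y : F, y ≠ 0 → ∀ r : ℝ, 0 < r →
      (vectorFieldCoord toFun e (x, r • y)).2 = r ^ 2 • (vectorFieldCoord toFun e (x, y)).2

namespace Spray

section

variable {F M : Type*} [NormedAddCommGroup F] [NormedSpace ℝ F]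
  [TopologicalSpace M] [ChartedSpace F M] [IsManifold 𝓘(ℝ, F) ∞ M]

/-- The spray coefficients `G(x, y) = (Gⁱ(x, y))ᵢ` in the chart `e`. -/
def coeff (S : Spray F M) (e : OpenPartialHomeomorph M F) (x y : F) : F :=
  -(1 / 2 : ℝ) • (vectorFieldCoord S.toFun e (x, y)).2

/-- The functions `Nⁱⱼ = ∂Gⁱ/∂yʲ` in the chart `e`, as the linear map `v ↦ Nⁱⱼ(x, y) vʲ`. -/
def connCoeff (S : Spray F M) (e : OpenPartialHomeomorph M F) (x y : F) : F →L[ℝ] F :=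
  fderiv ℝ (fun y' ↦ S.coeff e x y') y

/-- `c` restricted to the open set `J` is a geodesic: a smooth curve with nowhere vanishing velocity
such that `(c, ċ)` is an integral curve of the spray. -/
structure IsGeodesicOn (S : Spray F M) (c : ℝ → M) (J : Set ℝ) : Prop where
  contMDiffOn : ContMDiffOn 𝓘(ℝ, ℝ) 𝓘(ℝ, F) ∞ c J
  velocity_ne_zero : ∀ t ∈ J, velocity (F := F) c t ≠ 0
  isMIntegralCurveOn : IsMIntegralCurveOn (I := 𝓘(ℝ, F).tangent) (velocityLift F c) S.toFun J

/-- `Z` is the linearly covariant derivative `D_{ċ(t)} W(t)` of the vector field `W` along the curve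
`c` at time `t`: it is a tangent vector at `c(t)` and, in every standard local coordinate system
around `c(t)`, it is given by `Zⁱ = dWⁱ/dt + Nⁱⱼ(c(t), ċ(t)) Wʲ(t)` (the derivative being required
to exist). There is at most one such `Z`. -/
def HasCovDerivAt (S : Spray F M) (c : ℝ → M) (W : ℝ → TangentBundle 𝓘(ℝ, F) M)
    (Z : TangentBundle 𝓘(ℝ, F) M) (t : ℝ) : Prop :=
  Z.proj = c t ∧
  ∀ e ∈ IsManifold.maximalAtlas 𝓘(ℝ, F) ∞ M, c t ∈ e.source →
    ∃ dW : F, HasDerivAt (fun s ↦ (tangentCoord e (W s)).2) dW t ∧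
      (tangentCoord e Z).2 = dW +
        S.connCoeff e (e (c t)) (tangentCoord e (velocityLift F c t)).2 (tangentCoord e (W t)).2

/-- `W` is linearly parallel along `c` (over `J`): `D_{ċ(t)} W(t) = 0` for all `t`. -/
def IsLinearlyParallelOn (S : Spray F M) (c : ℝ → M) (W : ℝ → TangentBundle 𝓘(ℝ, F) M)
    (J : Set ℝ) : Prop :=
  ∀ t ∈ J, S.HasCovDerivAt c W ⟨c t, 0⟩ t

/-- A spray is invariant under the action of `G` if `(g_*)_* S = S` on `TM \ 0` for all `g`. -/
def IsInvariant (S : Spray F M) (G : Type*) [SMul G M] : Prop :=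
  ∀ g : G, ∀ p ∈ slitTangentBundle F M,
    mfderiv 𝓘(ℝ, F).tangent 𝓘(ℝ, F).tangent
      (tangentMap 𝓘(ℝ, F) 𝓘(ℝ, F) (fun x : M ↦ g • x)) p (S.toFun p) =
    S.toFun (tangentMap 𝓘(ℝ, F) 𝓘(ℝ, F) (fun x : M ↦ g • x) p)

end

end Spray

/-- `W` is a smooth vector field along the curve `c`, over the open set `J`. -/
structure IsSmoothFieldAlongOn {F M : Type*} [NormedAddCommGroup F] [NormedSpace ℝ F]
    [TopologicalSpace M] [ChartedSpace F M] [IsManifold 𝓘(ℝ, F) ∞ M]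
    (c : ℝ → M) (W : ℝ → TangentBundle 𝓘(ℝ, F) M) (J : Set ℝ) : Prop where
  proj_eq : ∀ t ∈ J, (W t).proj = c t
  contMDiffOn : ContMDiffOn 𝓘(ℝ, ℝ) 𝓘(ℝ, F).tangent ∞ W J

/-! ### Lie groups and coset spaces -/

section LieGroup

variable {E : Type*} [NormedAddCommGroup E] [NormedSpace ℝ E]
  {G : Type*} [Group G] [TopologicalSpace G] [ChartedSpace E G]

theorem velocityLift_mul [LieGroup 𝓘(ℝ, E) ∞ G] {a b : ℝ → G} {v w : GroupLieAlgebra 𝓘(ℝ, E) G}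
    (ha : MDifferentiableAt 𝓘(ℝ, ℝ) 𝓘(ℝ, E) a 0) (hb : MDifferentiableAt 𝓘(ℝ, ℝ) 𝓘(ℝ, E) b 0)
    (hav : velocityLift E a 0 = ⟨1, v⟩) (hbw : velocityLift E b 0 = ⟨1, w⟩) :
    velocityLift E (fun t ↦ a t * b t) 0 = ⟨1, v + w⟩ := by
  have hm (p : G × G) : MDifferentiableAt (𝓘(ℝ, E).prod 𝓘(ℝ, E)) 𝓘(ℝ, E)
      (fun p : G × G ↦ p.1 * p.2) p :=
    (contMDiff_mul 𝓘(ℝ, E) ∞).mdifferentiable (by simp) _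
  have h1 : velocity (F := E) (fun t ↦ a t * b t) 0 =
      mfderiv 𝓘(ℝ, E) 𝓘(ℝ, E) (fun z ↦ z * b 0) (a 0) (velocity a 0) +
      mfderiv 𝓘(ℝ, E) 𝓘(ℝ, E) (fun z ↦ a 0 * z) (b 0) (velocity b 0) := by
    have h := mfderiv_comp (0 : ℝ) (g := fun p : G × G ↦ p.1 * p.2) (f := fun t ↦ (a t, b t))
      (hm _) (ha.prodMk hb)
    have h' := congrArg (fun L ↦ L (1 : ℝ)) h
    refine h'.trans ?_
    rw [mfderiv_prodMk ha hb]
    exact mfderiv_prod_eq_add_apply (hm _)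
  have h2 : velocityLift E (fun t ↦ a t * b t) 0 =
      ⟨(velocityLift E a 0).proj * (velocityLift E b 0).proj,
        mfderiv 𝓘(ℝ, E) 𝓘(ℝ, E) (fun z ↦ z * (velocityLift E b 0).proj)
          (velocityLift E a 0).proj (velocityLift E a 0).snd +
        mfderiv 𝓘(ℝ, E) 𝓘(ℝ, E) (fun z ↦ (velocityLift E a 0).proj * z)
          (velocityLift E b 0).proj (velocityLift E b 0).snd⟩ :=
    congrArg (TotalSpace.mk (F := E) (E := TangentSpace 𝓘(ℝ, E)) (a 0 * b 0)) h1
  rw [h2, hav, hbw]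
  have e1 : (fun z : G ↦ z * 1) = id := funext mul_one
  have e2 : (fun z : G ↦ 1 * z) = id := funext one_mul
  have d1 : ∀ u : E, mfderiv 𝓘(ℝ, E) 𝓘(ℝ, E) (fun z : G ↦ z * 1) 1 u = u := by
    rw [e1, mfderiv_id]; exact fun _ ↦ rfl
  have d2 : ∀ u : E, mfderiv 𝓘(ℝ, E) 𝓘(ℝ, E) (fun z : G ↦ 1 * z) 1 u = u := by
    rw [e2, mfderiv_id]; exact fun _ ↦ rfl
  have key : ∀ (x : G) (u u' : E), x = 1 → u = u' →
      (⟨x, u⟩ : TangentBundle 𝓘(ℝ, E) G) = ⟨1, u'⟩ := by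
    rintro x u u' rfl rfl; rfl
  refine key _ _ _ (one_mul 1) ?_
  exact congrArg₂ (fun p q : E ↦ p + q) (d1 v) (d2 w)

theorem velocityLift_const_mul {a : ℝ → G} {v : GroupLieAlgebra 𝓘(ℝ, E) G} (r : ℝ)
    (ha : MDifferentiableAt 𝓘(ℝ, ℝ) 𝓘(ℝ, E) a 0) (hav : velocityLift E a 0 = ⟨1, v⟩) :
    velocityLift E (fun t ↦ a (r * t)) 0 = ⟨1, r • v⟩ := by
  have h0 : r * (0 : ℝ) = 0 := mul_zero r
  have hr : HasMFDerivAt 𝓘(ℝ, ℝ) 𝓘(ℝ, ℝ) (fun t : ℝ ↦ r * t) 0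
      (r • ContinuousLinearMap.id ℝ ℝ) :=
    ((hasFDerivAt_id (𝕜 := ℝ) (0 : ℝ)).const_mul r).hasMFDerivAt
  have ha' : MDifferentiableAt 𝓘(ℝ, ℝ) 𝓘(ℝ, E) a (r * 0) := by rwa [h0]
  have h1 : velocity (F := E) (fun t ↦ a (r * t)) 0 =
      mfderiv 𝓘(ℝ, ℝ) 𝓘(ℝ, E) a (r * 0) (r * 1 : ℝ) :=
    congrArg (fun L ↦ L (1 : ℝ)) (HasMFDerivAt.comp (0 : ℝ) ha'.hasMFDerivAt hr).mfderiv
  have h2 : velocity (F := E) (fun t ↦ a (r * t)) 0 = r • velocity (F := E) a (r * 0) :=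
    h1.trans ((mfderiv 𝓘(ℝ, ℝ) 𝓘(ℝ, E) a (r * 0)).map_smul r (1 : ℝ))
  have h3 : velocityLift E (fun t ↦ a (r * t)) 0 =
      ⟨(velocityLift E a (r * 0)).proj, r • (velocityLift E a (r * 0)).snd⟩ :=
    congrArg (TotalSpace.mk (F := E) (E := TangentSpace 𝓘(ℝ, E)) (a (r * 0))) h2
  rw [h3, h0, hav]

/-- The Lie algebra `𝔥` of a closed subgroup `H`, as a subspace of `𝔤 = T_e G`: the initial
velocities of the smooth curves in `G` which start at `e` and stay in `H`. -/
def subgroupLieAlgebra (E : Type*) [NormedAddCommGroup E] [NormedSpace ℝ E]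
    {G : Type*} [Group G] [TopologicalSpace G] [ChartedSpace E G] [LieGroup 𝓘(ℝ, E) ∞ G]
    (H : Subgroup G) : Submodule ℝ (GroupLieAlgebra 𝓘(ℝ, E) G) where
  carrier := {v | ∃ γ : ℝ → G, ContMDiff 𝓘(ℝ, ℝ) 𝓘(ℝ, E) ∞ γ ∧ (∀ t, γ t ∈ H) ∧
    velocityLift E γ 0 = ⟨1, v⟩}
  zero_mem' := ⟨fun _ ↦ 1, contMDiff_const, fun _ ↦ H.one_mem, by
    simp only [velocityLift, velocity, mfderiv_const]; rfl⟩
  add_mem' := by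
    rintro v w ⟨a, ha, haH, hav⟩ ⟨b, hb, hbH, hbw⟩
    exact ⟨fun t ↦ a t * b t, ha.mul hb, fun t ↦ H.mul_mem (haH t) (hbH t),
      velocityLift_mul (ha.mdifferentiable (by simp) 0) (hb.mdifferentiable (by simp) 0) hav hbw⟩
  smul_mem' := by
    rintro r v ⟨a, ha, haH, hav⟩
    refine ⟨fun t ↦ a (r * t), ha.comp (contDiff_const.mul contDiff_id).contMDiff,
      fun t ↦ haH _, velocityLift_const_mul r (ha.mdifferentiable (by simp) 0) hav⟩

end LieGroup

section CosetSpace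

variable {E : Type*} [NormedAddCommGroup E] [NormedSpace ℝ E]
  {F : Type*} [NormedAddCommGroup F] [NormedSpace ℝ F]
  {G : Type*} [Group G] [TopologicalSpace G] [ChartedSpace E G]
  {H : Subgroup G} [ChartedSpace F (G ⧸ H)]

variable (E F) in
/-- For `g ∈ G` and `v ∈ 𝔤 = T_e G` this is `g_* (π_* v)`, where `π : G → G/H` is the projection and
`g_*` the differential of the action of `g` on `G/H`. For `v ∈ 𝔪` this is `g_* v`, because a vector
`v ∈ 𝔪` is identified with `π_* v ∈ T_o(G/H)`. -/
def cosetPush (H : Subgroup G) [ChartedSpace F (G ⧸ H)]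
    (g : G) (v : GroupLieAlgebra 𝓘(ℝ, E) G) : TangentBundle 𝓘(ℝ, F) (G ⧸ H) :=
  tangentMap 𝓘(ℝ, F) 𝓘(ℝ, F) (fun x : G ⧸ H ↦ g • x)
    (tangentMap 𝓘(ℝ, E) 𝓘(ℝ, F) (fun a : G ↦ (a : G ⧸ H)) ⟨1, v⟩)

/-- The curve `cbar` in `G` (over `J ∋ 0`) is the lift of the curve `c` in `G/H`: it is smooth, with
`cbar(0) = e`, `c(t) = cbar(t) · o` and `y(t) = (L_{cbar(t)⁻¹})_* (d/dt cbar(t)) ∈ 𝔪 \ {0}`; the last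
equation is written as `d/dt cbar(t) = (L_{cbar(t)})_* y(t)`. -/
structure IsLiftOn {𝔪 : Submodule ℝ (GroupLieAlgebra 𝓘(ℝ, E) G)}
    (c : ℝ → G ⧸ H) (cbar : ℝ → G) (y : ℝ → 𝔪) (J : Set ℝ) : Prop where
  contMDiffOn : ContMDiffOn 𝓘(ℝ, ℝ) 𝓘(ℝ, E) ∞ cbar J
  map_zero : cbar 0 = 1
  eq_smul : ∀ t ∈ J, c t = cbar t • ((1 : G) : G ⧸ H)
  velocity_eq : ∀ t ∈ J,
    velocity cbar t = mulInvariantVectorField (y t : GroupLieAlgebra 𝓘(ℝ, E) G) (cbar t)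
  ne_zero : ∀ t ∈ J, y t ≠ 0

variable [IsManifold 𝓘(ℝ, F) ∞ (G ⧸ H)]

/-- `v = -d/dt|₀ y(t)`, where `y(t)` is obtained from the lift of the geodesic `c` in `G/H` with
`c(0) = o` and `ċ(0) = y₀ ∈ 𝔪 = T_o(G/H)`. -/
def IsSprayVector (S : Spray F (G ⧸ H)) (𝔪 : Submodule ℝ (GroupLieAlgebra 𝓘(ℝ, E) G))
    (y₀ v : 𝔪) : Prop :=
  ∃ (ε : ℝ) (c : ℝ → G ⧸ H) (cbar : ℝ → G) (y : ℝ → 𝔪), 0 < ε ∧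
    S.IsGeodesicOn c (Ioo (-ε) ε) ∧
    velocityLift F c 0 = cosetPush E F H 1 y₀ ∧
    IsLiftOn c cbar y (Ioo (-ε) ε) ∧
    HasDerivAt y (-v) 0

/-- The spray vector field `η : 𝔪 \ {0} → 𝔪` of a homogeneous spray on `G/H`. -/
def sprayVectorField (S : Spray F (G ⧸ H)) (𝔪 : Submodule ℝ (GroupLieAlgebra 𝓘(ℝ, E) G))
    (y : 𝔪) : 𝔪 :=
  Classical.epsilon fun v ↦ IsSprayVector S 𝔪 y v

/-- The bracket `[y, w]_𝔪`: the `𝔪`-component of `[y, w]` with respect to `𝔤 = 𝔥 + 𝔪`. -/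
def bracketProj {𝔥 𝔪 : Submodule ℝ (GroupLieAlgebra 𝓘(ℝ, E) G)} (h : IsCompl 𝔥 𝔪) (y w : 𝔪) : 𝔪 :=
  𝔪.projectionOnto 𝔥 h.symm ⁅(y : GroupLieAlgebra 𝓘(ℝ, E) G), (w : GroupLieAlgebra 𝓘(ℝ, E) G)⁆

/-- The connection operator `N(y, w) = ½ Dη(y, w) - ½ [y, w]_𝔪`, where
`Dη(y, w) = d/dt|₀ η(y + t w)`. -/
def connectionOperator (S : Spray F (G ⧸ H)) {𝔥 𝔪 : Submodule ℝ (GroupLieAlgebra 𝓘(ℝ, E) G)}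
    (h : IsCompl 𝔥 𝔪) (y w : 𝔪) : 𝔪 :=
  (1 / 2 : ℝ) • deriv (fun t : ℝ ↦ sprayVectorField S 𝔪 (y + t • w)) 0 - (1 / 2 : ℝ) • bracketProj h y w

end CosetSpace

end SprayGeometry

end

/-! Everything is pulled back to `G` and differentiated along left invariant vector fields. Let `e`
be a chart of `G/H`, `f = e ∘ π`, `A_g(v)` the derivative of `f` at `g` along the left invariant
field `v`, and `B_g(v, w)` the derivative along `v` of `g ↦ A_g(w)`. Then `A_g` is onto with kernel
`𝔥`, so it is injective on `𝔪`, and `A_g(w)` is the coordinate vector of `g_* w`. Left invariant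
fields commute up to the bracket, hence `B_g(v, w) - B_g(w, v) = A_g([v, w])`, where `[v, w]` may be
replaced by its `𝔪`-component (`leftDeriv_leftDeriv_sub`, `leftDeriv_bracketProj`).

Let `c` be a geodesic with lift `cbar` and left velocity `y`. Its translate `g c` has coordinate
velocity `A(y)`, taken at `g cbar(t)`, and is again tangent to the spray by invariance. The product
rule turns the geodesic equation at `t = 0` into `A(η(y)) = 2 G(f, A y) + B(y, y)` at every `g`
(`IsSprayVector.leftDeriv_eq`). Differentiating in `y` along `w` gives `A(Dη(y, w)) = 2 (∂G/∂y)(A w)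
+ B(w, y) + B(y, w)`. Halving this and adding half of the bracket identity cancels `B(w, y)`:
`A(N(y, w) + [y, w]_𝔪) = (∂G/∂y)(A w) + B(y, w)` (`leftDeriv_connectionOperator_add`).

On the other side, `W` has coordinates `A(w)` along `cbar`, with derivative `B(y, w) + A(w')`.
Adding the connection term gives `A(w' + N(y, w) + [y, w]_𝔪)`, which is the formula; injectivity of
`A` on `𝔪` gives the criterion for parallel fields.

Two points need separate arguments. The spray vector field is a choice, so geodesics and their lifts
must be shown to exist (`exists_isSprayVector`, by an ODE on `G × 𝔪` in coordinates). And
differentiability of `w` is a conclusion: it is recovered from `W` by inverting a smoothly varying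
operator (`differentiableAt_of_field`). -/

namespace SprayGeometry

/-! ### Differentiation along left invariant vector fields. -/

section LeftDerivative

variable (E : Type*) {G K : Type*} [NormedAddCommGroup E] [NormedSpace ℝ E]
  [Group G] [TopologicalSpace G] [ChartedSpace E G]
  [NormedAddCommGroup K] [NormedSpace ℝ K]

/-- The derivative `v ↦ (L_v f)(g)` of a function `f` on a Lie group along left invariant vector
fields, computed in the preferred chart at the identity. -/
noncomputable def leftDeriv (f : G → K) (g : G) : E →L[ℝ] K :=
  fderiv ℝ (fun x ↦ f (g * (chartAt E (1 : G)).symm x)) (chartAt E (1 : G) 1)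

variable {E}

theorem leftDeriv_congr {f f' : G → K} {g : G} [ContinuousMul G] (h : f =ᶠ[𝓝 g] f') :
    leftDeriv E f g = leftDeriv E f' g := by
  refine Filter.EventuallyEq.fderiv_eq ?_
  have h1 : ContinuousAt (fun x ↦ g * (chartAt E (1 : G)).symm x) (chartAt E (1 : G) 1) :=
    continuousAt_const.mul ((chartAt E (1 : G)).continuousAt_symm (mem_chart_target E 1))
  have h2 : g * (chartAt E (1 : G)).symm (chartAt E (1 : G) 1) = g := by
    rw [(chartAt E (1 : G)).left_inv (mem_chart_source E 1), mul_one]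
  have h3 := h1.tendsto
  rw [h2] at h3
  exact h3.eventually h

/-- Left invariance, which is just associativity of the product. It moves identities at a general
`g` to the identity element and lets curves be translated freely. -/
theorem leftDeriv_comp_mul_left (f : G → K) (g a : G) :
    leftDeriv E (fun b ↦ f (g * b)) a = leftDeriv E f (g * a) := by
  simp [leftDeriv, mul_assoc]

variable [LieGroup 𝓘(ℝ, E) ∞ G]

/-- The manifold derivative at `1` is by definition taken in the preferred chart at `1`, the chart
used in `leftDeriv`, so no change of charts appears. -/
theorem mfderiv_comp_mul_left {f : G → K} {g : G}
    (hf : MDifferentiableAt 𝓘(ℝ, E) 𝓘(ℝ, K) f g) (v : E) :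
    (mfderiv 𝓘(ℝ, E) 𝓘(ℝ, K) (fun a ↦ f (g * a)) 1 v : K) = leftDeriv E f g v := by
  have h1 : MDifferentiableAt 𝓘(ℝ, E) 𝓘(ℝ, E) (fun a : G ↦ g * a) 1 :=
    (contMDiff_mul_left (I := 𝓘(ℝ, E)) (n := ∞)).mdifferentiable (by simp) _
  have h2 : MDifferentiableAt 𝓘(ℝ, E) 𝓘(ℝ, K) (fun a ↦ f (g * a)) 1 :=
    MDifferentiableAt.comp (g := f) (1 : G) (by simpa using hf) h1
  obtain ⟨L, hL, hL'⟩ : ∃ L : E →L[ℝ] K, HasFDerivWithinAt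
      (fun x ↦ f (g * (chartAt E (1 : G)).symm x)) L (range id) (chartAt E (1 : G) 1) ∧
      L v = mfderiv 𝓘(ℝ, E) 𝓘(ℝ, K) (fun a ↦ f (g * a)) 1 v :=
    ⟨_, h2.hasMFDerivAt.2, rfl⟩
  rw [range_id, hasFDerivWithinAt_univ] at hL
  exact hL'.symm.trans (congrArg (fun L : E →L[ℝ] K ↦ L v) hL.fderiv.symm)

theorem mfderiv_one {f : G → K} (hf : MDifferentiableAt 𝓘(ℝ, E) 𝓘(ℝ, K) f 1) (v : E) :
    (mfderiv 𝓘(ℝ, E) 𝓘(ℝ, K) f 1 v : K) = leftDeriv E f 1 v := by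
  have key : ∀ f' : G → K, f' = f → (mfderiv 𝓘(ℝ, E) 𝓘(ℝ, K) f 1 v : K) =
    mfderiv 𝓘(ℝ, E) 𝓘(ℝ, K) f' 1 v := by rintro _ rfl; rfl
  exact (key _ (funext fun a ↦ congrArg f (one_mul a))).trans (mfderiv_comp_mul_left hf v)

theorem mfderiv_mulInvariantVectorField {f : G → K} {g : G}
    (hf : MDifferentiableAt 𝓘(ℝ, E) 𝓘(ℝ, K) f g) (v : GroupLieAlgebra 𝓘(ℝ, E) G) :
    (mfderiv 𝓘(ℝ, E) 𝓘(ℝ, K) f g (mulInvariantVectorField v g) : K) = leftDeriv E f g v := by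
  refine Eq.trans ?_ (mfderiv_comp_mul_left hf v)
  have h1 : MDifferentiableAt 𝓘(ℝ, E) 𝓘(ℝ, E) (fun a : G ↦ g * a) 1 :=
    (contMDiff_mul_left (I := 𝓘(ℝ, E)) (n := ∞)).mdifferentiable (by simp) _
  have h2 := mfderiv_comp (I' := 𝓘(ℝ, E)) (1 : G) (g := f) (by simpa using hf) h1
  have h3 : (mfderiv 𝓘(ℝ, E) 𝓘(ℝ, K) (fun a ↦ f (g * a)) 1 v : K) =
    mfderiv 𝓘(ℝ, E) 𝓘(ℝ, K) f (g * 1) (mulInvariantVectorField v g) :=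
    congrArg (fun L ↦ L v) h2
  refine Eq.trans ?_ h3.symm
  have key : ∀ (g' : G) (u : E), g' = g → (mfderiv 𝓘(ℝ, E) 𝓘(ℝ, K) f g' u : K) =
    mfderiv 𝓘(ℝ, E) 𝓘(ℝ, K) f g u := by rintro _ _ rfl; rfl
  exact (key _ _ (mul_one g)).symm

theorem hasDerivAt_comp_of_velocity_eq {f : G → K} {γ : ℝ → G} {t : ℝ}
    {v : GroupLieAlgebra 𝓘(ℝ, E) G}
    (hγ : MDifferentiableAt 𝓘(ℝ, ℝ) 𝓘(ℝ, E) γ t)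
    (hv : velocity γ t = mulInvariantVectorField v (γ t))
    (hf : MDifferentiableAt 𝓘(ℝ, E) 𝓘(ℝ, K) f (γ t)) :
    HasDerivAt (fun s ↦ f (γ s)) (leftDeriv E f (γ t) v) t := by
  obtain ⟨L, hL, hL'⟩ : ∃ L : ℝ →L[ℝ] K, HasFDerivAt (fun s ↦ f (γ s)) L t ∧
      L 1 = mfderiv 𝓘(ℝ, E) 𝓘(ℝ, K) f (γ t) (velocity γ t) :=
    ⟨_, (hf.hasMFDerivAt.comp t hγ.hasMFDerivAt).hasFDerivAt, rfl⟩
  have h1 : L 1 = leftDeriv E f (γ t) v :=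
    hL'.trans ((congrArg _ hv).trans (mfderiv_mulInvariantVectorField hf v))
  exact h1 ▸ hL.hasDerivAt

/-- With `g` read in a chart, this is a partial derivative of the jointly smooth function `(x, x') ↦
f (e.symm x * κ.symm x')` with respect to `x'`, at a fixed value of `x'`. -/
theorem contMDiffAt_leftDeriv {f : G → K} {g : G} (hf : ContMDiffAt 𝓘(ℝ, E) 𝓘(ℝ, K) ∞ f g) :
    ContMDiffAt 𝓘(ℝ, E) 𝓘(ℝ, E →L[ℝ] K) ∞ (leftDeriv E f) g := by
  set κ := chartAt E (1 : G)
  set e := chartAt E g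
  have h1 : ContMDiffAt 𝓘(ℝ, E × E) 𝓘(ℝ, E) ∞ (fun p : E × E ↦ e.symm p.1 * κ.symm p.2)
      (e g, κ 1) := by
    refine ContMDiffAt.mul ?_ ?_
    · exact ContMDiffAt.comp (e g, κ 1) (contMDiffAt_symm_of_mem_maximalAtlas
        (IsManifold.chart_mem_maximalAtlas g) (mem_chart_target E g))
        contDiff_fst.contMDiff.contMDiffAt
    · exact ContMDiffAt.comp (e g, κ 1) (contMDiffAt_symm_of_mem_maximalAtlas
        (IsManifold.chart_mem_maximalAtlas 1) (mem_chart_target E 1))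
        contDiff_snd.contMDiff.contMDiffAt
  have h2 : ContDiffAt ℝ ∞ (Function.uncurry fun x x' : E ↦ f (e.symm x * κ.symm x'))
      (e g, κ 1) := by
    refine ContMDiffAt.contDiffAt (ContMDiffAt.comp (g := f) (e g, κ 1) ?_ h1)
    simpa [e, κ] using hf
  have h3 : ContDiffAt ℝ ∞ (fun x ↦ leftDeriv E f (e.symm x)) (e g) :=
    ContDiffAt.fderiv h2 contDiffAt_const (by simp)
  have h4 : ContMDiffAt 𝓘(ℝ, E) 𝓘(ℝ, E →L[ℝ] K) ∞
      ((fun x ↦ leftDeriv E f (e.symm x)) ∘ e) g :=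
    h3.contMDiffAt.comp g (contMDiffAt_of_mem_maximalAtlas
        (IsManifold.chart_mem_maximalAtlas g) (mem_chart_source E g))
  refine h4.congr_of_eventuallyEq ?_
  filter_upwards [e.open_source.mem_nhds (mem_chart_source E g)] with a ha
  simp [e.left_inv ha]

end LeftDerivative

/-! ### Chain rules, and the Lie bracket as a commutator of left derivatives. -/

section LeftDerivative

variable {E G K : Type*} [NormedAddCommGroup E] [NormedSpace ℝ E]
  [Group G] [TopologicalSpace G] [ChartedSpace E G]
  [NormedAddCommGroup K] [NormedSpace ℝ K]

theorem leftDeriv_one (f : G → K) : leftDeriv E f 1 =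
    fderiv ℝ (fun x ↦ f ((chartAt E (1 : G)).symm x)) (chartAt E (1 : G) 1) := by
  simp [leftDeriv]

theorem leftDeriv_chartAt_one :
    leftDeriv E (chartAt E (1 : G)) 1 = ContinuousLinearMap.id ℝ E := by
  rw [leftDeriv_one]
  have : (fun x ↦ chartAt E (1 : G) ((chartAt E (1 : G)).symm x)) =ᶠ[𝓝 (chartAt E (1 : G) 1)]
      id := by
    filter_upwards [(chartAt E (1 : G)).open_target.mem_nhds (mem_chart_target E 1)] with x hx
    exact (chartAt E (1 : G)).right_inv hx
  rw [this.fderiv_eq, fderiv_id]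

variable [LieGroup 𝓘(ℝ, E) ∞ G]

theorem mdifferentiableAt_chartAt_one {a : G} (ha : a ∈ (chartAt E (1 : G)).source) :
    MDifferentiableAt 𝓘(ℝ, E) 𝓘(ℝ, E) (chartAt E (1 : G)) a :=
  (contMDiffAt_of_mem_maximalAtlas (I := 𝓘(ℝ, E)) (n := ∞)
    (IsManifold.chart_mem_maximalAtlas 1) ha).mdifferentiableAt (by simp)

theorem differentiableAt_comp_mul_left {f : G → K} {g : G}
    (hf : MDifferentiableAt 𝓘(ℝ, E) 𝓘(ℝ, K) f g) :
    DifferentiableAt ℝ (fun x ↦ f (g * (chartAt E (1 : G)).symm x)) (chartAt E (1 : G) 1) := by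
  refine mdifferentiableAt_iff_differentiableAt.1 (MDifferentiableAt.comp (g := f) _ ?_
    (((contMDiff_mul_left (I := 𝓘(ℝ, E)) (n := ∞) (a := g)).mdifferentiable (by simp) _).comp _
      ((contMDiffAt_symm_of_mem_maximalAtlas (I := 𝓘(ℝ, E)) (n := ∞)
        (IsManifold.chart_mem_maximalAtlas 1) (mem_chart_target E (1 : G))).mdifferentiableAt
          (by simp))))
  simpa using hf

theorem leftDeriv_comp {L : Type*} [NormedAddCommGroup L] [NormedSpace ℝ L] {f : G → K}
    {h : K → L} {g : G} (hf : MDifferentiableAt 𝓘(ℝ, E) 𝓘(ℝ, K) f g)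
    (hh : DifferentiableAt ℝ h (f g)) :
    leftDeriv E (fun a ↦ h (f a)) g = (fderiv ℝ h (f g)).comp (leftDeriv E f g) := by
  have e1 : g * (chartAt E (1 : G)).symm (chartAt E (1 : G) 1) = g := by
    rw [(chartAt E (1 : G)).left_inv (mem_chart_source E 1), mul_one]
  have := fderiv_comp (chartAt E (1 : G) 1) (g := h) (by rwa [e1])
    (differentiableAt_comp_mul_left hf)
  rwa [e1] at this

/-- The left derivative of the chart itself lists the components of the left invariant fields; any
other function is differentiated by pairing its ordinary differential with them. -/
theorem leftDeriv_eq_fderiv_comp {f : G → K} {a : G} (ha : a ∈ (chartAt E (1 : G)).source)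
    (hf : MDifferentiableAt 𝓘(ℝ, E) 𝓘(ℝ, K) f a) :
    leftDeriv E f a = (fderiv ℝ (fun x ↦ f ((chartAt E (1 : G)).symm x)) (chartAt E (1 : G) a)).comp
      (leftDeriv E (chartAt E (1 : G)) a) := by
  set κ := chartAt E (1 : G)
  have : ContinuousMul G := (topologicalGroup_of_lieGroup 𝓘(ℝ, E) ∞).toContinuousMul
  have h1 : leftDeriv E f a = leftDeriv E (fun b ↦ f (κ.symm (κ b))) a := by
    refine leftDeriv_congr ?_
    filter_upwards [κ.open_source.mem_nhds ha] with b hb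
    rw [κ.left_inv hb]
  rw [h1]
  refine leftDeriv_comp (mdifferentiableAt_chartAt_one ha) (mdifferentiableAt_iff_differentiableAt.1
    (MDifferentiableAt.comp (g := f) (κ a) (by rwa [κ.left_inv ha])
    ((contMDiffAt_symm_of_mem_maximalAtlas (I := 𝓘(ℝ, E)) (n := ∞)
      (IsManifold.chart_mem_maximalAtlas 1) (κ.map_source ha)).mdifferentiableAt (by simp))))

variable (G) in
/-- The Lie bracket of the Lie algebra of `G`, on the model space `E` of `G`. -/
noncomputable def modelBracket (v w : E) : E :=
  Bracket.bracket (L := GroupLieAlgebra 𝓘(ℝ, E) G) (M := GroupLieAlgebra 𝓘(ℝ, E) G) v w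

/-- The bracket is computed from the invariant fields pulled back to the chart at `1`. These
pullbacks `X u` are the functions `x ↦ leftDeriv E κ (κ.symm x) u`, with `X u (κ 1) = u`, so the
bracket of vector fields on `E` becomes a difference of second left derivatives. -/
theorem modelBracket_eq_leftDeriv (v w : E) : modelBracket G v w =
      (leftDeriv E (leftDeriv E (chartAt E (1 : G))) (1 : G) v w -
        leftDeriv E (leftDeriv E (chartAt E (1 : G))) (1 : G) w v : E) := by
  set κ := chartAt E (1 : G) with hκ
  let X : E → E → E := fun u ↦ VectorField.mpullbackWithin 𝓘(ℝ, E) 𝓘(ℝ, E) (extChartAt 𝓘(ℝ, E) (1 : G)).symm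
    (mulInvariantVectorField (u : GroupLieAlgebra 𝓘(ℝ, E) G)) (range 𝓘(ℝ, E))
  have hX : ∀ u : E, ∀ x ∈ κ.target, X u x = leftDeriv E κ (κ.symm x) u := by
    intro u x hx
    have hx' : x ∈ (extChartAt 𝓘(ℝ, E) (1 : G)).target := by simpa using hx
    have h1 := isInvertible_mfderivWithin_extChartAt_symm (I := 𝓘(ℝ, E)) hx'
    have h2 := mfderivWithin_extChartAt_symm_comp_mfderiv_extChartAt (I := 𝓘(ℝ, E)) hx'
    refine Eq.trans ?_ (mfderiv_mulInvariantVectorField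
      (mdifferentiableAt_chartAt_one (κ.map_target hx)) u)
    exact h1.inverse_apply_eq.2 (congrArg (fun L ↦ L (mulInvariantVectorField
      (u : GroupLieAlgebra 𝓘(ℝ, E) G) (κ.symm x))) h2).symm
  have h1 : modelBracket G v w =
      (mfderiv 𝓘(ℝ, E) 𝓘(ℝ, E) (extChartAt 𝓘(ℝ, E) (1 : G)) 1).inverse
        (VectorField.lieBracketWithin ℝ (X v) (X w)
          ((extChartAt 𝓘(ℝ, E) (1 : G)).symm ⁻¹' univ ∩ range 𝓘(ℝ, E)) (κ 1) : E) := rfl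
  have h2 : ∀ u : E, (mfderiv 𝓘(ℝ, E) 𝓘(ℝ, E) (extChartAt 𝓘(ℝ, E) (1 : G)) 1).inverse u =
      (u : GroupLieAlgebra 𝓘(ℝ, E) G) := by
    intro u
    have h3 := isInvertible_mfderiv_extChartAt (I := 𝓘(ℝ, E)) (mem_extChartAt_source (1 : G))
    refine h3.inverse_apply_eq.2 ?_
    exact (congrArg (fun L ↦ L (u : GroupLieAlgebra 𝓘(ℝ, E) G))
      (mfderiv_extChartAt_self (I := 𝓘(ℝ, E)) (x := (1 : G)))).symm
  have h3 : ∀ u u' : E, fderiv ℝ (X u) (κ 1) u' = leftDeriv E (leftDeriv E κ) 1 u' u := by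
    intro u u'
    have h4 : X u =ᶠ[𝓝 (κ 1)] fun x ↦ leftDeriv E κ (κ.symm x) u := by
      filter_upwards [κ.open_target.mem_nhds (mem_chart_target E 1)] with x hx using hX u x hx
    have h5 : DifferentiableAt ℝ (fun x ↦ leftDeriv E κ (κ.symm x)) (κ 1) := by
      refine mdifferentiableAt_iff_differentiableAt.1
        (MDifferentiableAt.comp (g := leftDeriv E κ) (κ 1) ?_
        ((contMDiffAt_symm_of_mem_maximalAtlas (I := 𝓘(ℝ, E)) (n := ∞)
          (IsManifold.chart_mem_maximalAtlas 1) (mem_chart_target E 1)).mdifferentiableAt (by simp)))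
      rw [κ.left_inv (mem_chart_source E 1)]
      exact (contMDiffAt_leftDeriv (contMDiffAt_of_mem_maximalAtlas (I := 𝓘(ℝ, E)) (n := ∞)
        (IsManifold.chart_mem_maximalAtlas 1) (mem_chart_source E 1))).mdifferentiableAt (by simp)
    rw [h4.fderiv_eq, leftDeriv_one, fderiv_clm_apply h5 (differentiableAt_const _)]
    simp
    rfl
  have h6 : ∀ u : E, X u (κ 1) = u := by
    intro u
    rw [hX u _ (mem_chart_target E 1), κ.left_inv (mem_chart_source E 1), leftDeriv_chartAt_one]
    rfl
  refine h1.trans ((h2 _).trans ?_)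
  rw [preimage_univ, univ_inter, modelWithCornersSelf_coe, range_id,
    VectorField.lieBracketWithin_univ, VectorField.lieBracket, h6, h6, h3, h3]

/-- After translation to `g = 1`, the second left derivative is the ordinary second derivative of
`f` in the chart plus the first derivative of `f` applied to the second left derivative of the
chart. Antisymmetrizing kills the first term, and the second yields the bracket by
`modelBracket_eq_leftDeriv`. -/
theorem leftDeriv_leftDeriv_sub {f : G → K} {g : G}
    (hf : ContMDiffAt 𝓘(ℝ, E) 𝓘(ℝ, K) ∞ f g) (v w : E) :
    leftDeriv E (leftDeriv E f) g v w - leftDeriv E (leftDeriv E f) g w v =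
      leftDeriv E f g (modelBracket G v w) := by
  wlog hg : g = 1 generalizing f g
  · have h1 : ContMDiffAt 𝓘(ℝ, E) 𝓘(ℝ, K) ∞ (fun a ↦ f (g * a)) 1 := by
      refine ContMDiffAt.comp (g := f) (1 : G) (by simpa using hf)
        (contMDiff_mul_left (I := 𝓘(ℝ, E)) (n := ∞)).contMDiffAt
    have h2 := this h1 rfl
    have h3 : leftDeriv E (fun a ↦ f (g * a)) = fun a ↦ leftDeriv E f (g * a) :=
      funext (leftDeriv_comp_mul_left f g)
    rw [h3, leftDeriv_comp_mul_left (leftDeriv E f), mul_one] at h2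
    beta_reduce at h2
    rwa [mul_one] at h2
  subst hg
  set κ := chartAt E (1 : G) with hκ
  have hmem := κ.open_target.mem_nhds (mem_chart_target E (1 : G))
  have hsymm : ContMDiffAt 𝓘(ℝ, E) 𝓘(ℝ, E) ∞ κ.symm (κ 1) :=
    contMDiffAt_symm_of_mem_maximalAtlas
      (IsManifold.chart_mem_maximalAtlas 1) (mem_chart_target E 1)
  have e1 : κ.symm (κ 1) = 1 := κ.left_inv (mem_chart_source E 1)
  have hfh : ContDiffAt ℝ ∞ (fun x ↦ f (κ.symm x)) (κ 1) :=
    (ContMDiffAt.comp (g := f) (κ 1) (by rwa [e1]) hsymm).contDiffAt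
  have hV : DifferentiableAt ℝ (fun x ↦ leftDeriv E κ (κ.symm x)) (κ 1) := by
    refine mdifferentiableAt_iff_differentiableAt.1
      (MDifferentiableAt.comp (g := leftDeriv E κ) (κ 1) ?_ (hsymm.mdifferentiableAt (by simp)))
    rw [e1]
    exact (contMDiffAt_leftDeriv (contMDiffAt_of_mem_maximalAtlas (I := 𝓘(ℝ, E)) (n := ∞)
      (IsManifold.chart_mem_maximalAtlas 1) (mem_chart_source E 1))).mdifferentiableAt (by simp)
  have hD : DifferentiableAt ℝ (fderiv ℝ (fun x ↦ f (κ.symm x))) (κ 1) :=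
    (hfh.fderiv_right (m := 1) (by norm_cast)).differentiableAt (by simp)
  have hev : (fun x ↦ leftDeriv E f (κ.symm x)) =ᶠ[𝓝 (κ 1)] fun x ↦
      (fderiv ℝ (fun x ↦ f (κ.symm x)) x).comp (leftDeriv E κ (κ.symm x)) := by
    have hd : ∀ᶠ a in 𝓝 (1 : G), MDifferentiableAt 𝓘(ℝ, E) 𝓘(ℝ, K) f a := by
      have := (contMDiffAt_iff_contMDiffAt_nhds (n := 1) (by simp)).1
        (hf.of_le (m := 1) (by norm_cast))
      exact this.mono fun a ha ↦ ha.mdifferentiableAt (by simp)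
    have hc := κ.continuousAt_symm (mem_chart_target E (1 : G))
    rw [← e1] at hd
    filter_upwards [hmem, hc.eventually hd] with x hx hx'
    have := leftDeriv_eq_fderiv_comp (κ.map_target hx) hx'
    rwa [κ.right_inv hx] at this
  have key : ∀ u u' : E, leftDeriv E (leftDeriv E f) 1 u u' =
      fderiv ℝ (fderiv ℝ (fun x ↦ f (κ.symm x))) (κ 1) u u' +
      leftDeriv E f 1 (leftDeriv E (leftDeriv E κ) 1 u u') := by
    intro u u'
    rw [leftDeriv_one (leftDeriv E f), hev.fderiv_eq, fderiv_clm_comp hD hV, leftDeriv_one f,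
      leftDeriv_one (leftDeriv E κ), e1, leftDeriv_chartAt_one]
    simp [add_comm]
    rfl
  have hs := hfh.isSymmSndFDerivAt (by simpa using (WithTop.coe_le_coe.2 le_top : ((2 : ℕ∞) : WithTop ℕ∞) ≤ ∞))
  rw [key, key, hs.eq v w]
  have := congrArg (leftDeriv E f 1) (modelBracket_eq_leftDeriv (G := G) v w)
  refine Eq.trans ?_ this.symm
  rw [map_sub]
  abel

end LeftDerivative

/-! ### Standard coordinates on the tangent bundle; integral curves in coordinates. -/

section TangentCoord

variable {F M : Type*} [NormedAddCommGroup F] [NormedSpace ℝ F]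
  [TopologicalSpace M] [ChartedSpace F M]

theorem tangentBundle_mk_congr {x x' : M} {v v' : F} (hx : x = x') (hv : v = v') :
    (⟨x, v⟩ : TangentBundle 𝓘(ℝ, F) M) = ⟨x', v'⟩ := by
  subst hx hv; rfl

variable {e : OpenPartialHomeomorph M F}

theorem mdifferentiable_of_mem_maximalAtlas (he : e ∈ IsManifold.maximalAtlas 𝓘(ℝ, F) ∞ M) :
    e.MDifferentiable 𝓘(ℝ, F) 𝓘(ℝ, F) :=
  ⟨(contMDiffOn_of_mem_maximalAtlas he).mdifferentiableOn (by simp),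
    (contMDiffOn_symm_of_mem_maximalAtlas he).mdifferentiableOn (by simp)⟩

theorem tangentOfCoord_tangentCoord (he : e ∈ IsManifold.maximalAtlas 𝓘(ℝ, F) ∞ M)
    {p : TangentBundle 𝓘(ℝ, F) M} (hp : p.proj ∈ e.source) :
    tangentOfCoord e (tangentCoord e p) = p := by
  obtain ⟨x, v⟩ := p
  refine tangentBundle_mk_congr (e.left_inv hp) ?_
  exact congrArg (fun L ↦ L v) ((mdifferentiable_of_mem_maximalAtlas he).symm_comp_deriv hp)

theorem tangentCoord_tangentOfCoord (he : e ∈ IsManifold.maximalAtlas 𝓘(ℝ, F) ∞ M)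
    {q : F × F} (hq : q.1 ∈ e.target) :
    tangentCoord e (tangentOfCoord e q) = q := by
  obtain ⟨x, v⟩ := q
  refine Prod.ext (e.right_inv hq) ?_
  exact congrArg (fun L ↦ L v) ((mdifferentiable_of_mem_maximalAtlas he).comp_symm_deriv hq)

theorem tangentCoord_injOn (he : e ∈ IsManifold.maximalAtlas 𝓘(ℝ, F) ∞ M) :
    InjOn (tangentCoord e) {p : TangentBundle 𝓘(ℝ, F) M | p.proj ∈ e.source} := by
  intro p hp q hq h
  rw [← tangentOfCoord_tangentCoord he hp, h, tangentOfCoord_tangentCoord he hq]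

theorem tangentCoord_snd_eq_zero_iff (he : e ∈ IsManifold.maximalAtlas 𝓘(ℝ, F) ∞ M)
    {p : TangentBundle 𝓘(ℝ, F) M} (hp : p.proj ∈ e.source) :
    (tangentCoord e p).2 = 0 ↔ p.snd = 0 := by
  refine ⟨fun h ↦ ?_, fun h ↦ ?_⟩
  · exact (mdifferentiable_of_mem_maximalAtlas he).mfderiv_injective hp (h.trans (map_zero _).symm)
  · exact (congrArg (mfderiv 𝓘(ℝ, F) 𝓘(ℝ, F) e p.proj) h).trans (map_zero _)

theorem hasDerivAt_comp_velocity {c : ℝ → M} {t : ℝ}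
    (he : e ∈ IsManifold.maximalAtlas 𝓘(ℝ, F) ∞ M)
    (hc : MDifferentiableAt 𝓘(ℝ, ℝ) 𝓘(ℝ, F) c t) (ht : c t ∈ e.source) :
    HasDerivAt (fun s ↦ e (c s)) (tangentCoord e (velocityLift F c t)).2 t := by
  have hd := (mdifferentiable_of_mem_maximalAtlas he).mdifferentiableAt ht
  obtain ⟨L, hL, hL'⟩ : ∃ L : ℝ →L[ℝ] F, HasFDerivAt (fun s ↦ e (c s)) L t ∧
      L 1 = (tangentCoord e (velocityLift F c t)).2 :=
    ⟨_, (hd.hasMFDerivAt.comp t hc.hasMFDerivAt).hasFDerivAt, rfl⟩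
  exact hL' ▸ hL.hasDerivAt

variable [IsManifold 𝓘(ℝ, F) ∞ M]

theorem isOpen_proj_preimage_source (e : OpenPartialHomeomorph M F) :
    IsOpen {p : TangentBundle 𝓘(ℝ, F) M | p.proj ∈ e.source} :=
  e.open_source.preimage (FiberBundle.continuous_proj F (TangentSpace 𝓘(ℝ, F)))

theorem contMDiffOn_tangentCoord (he : e ∈ IsManifold.maximalAtlas 𝓘(ℝ, F) ∞ M) :
    ContMDiffOn 𝓘(ℝ, F).tangent 𝓘(ℝ, F × F) ∞ (tangentCoord e)
      {p : TangentBundle 𝓘(ℝ, F) M | p.proj ∈ e.source} := by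
  have h1 : ContMDiffOn 𝓘(ℝ, F).tangent 𝓘(ℝ, F).tangent ∞
      (tangentMapWithin 𝓘(ℝ, F) 𝓘(ℝ, F) e e.source)
      {p : TangentBundle 𝓘(ℝ, F) M | p.proj ∈ e.source} :=
    (contMDiffOn_of_mem_maximalAtlas he).contMDiffOn_tangentMapWithin (by simp)
      e.open_source.uniqueMDiffOn
  have h2 := (contMDiff_snd_tangentBundle_modelSpace F 𝓘(ℝ, F) (n := ∞)).comp_contMDiffOn h1
  have h3 := (contMDiffOn_of_mem_maximalAtlas he).comp (t := e.source)
    (contMDiff_proj (TangentSpace 𝓘(ℝ, F) (M := M)) (n := ∞)).contMDiffOn (fun p hp ↦ hp)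
      (s := {p : TangentBundle 𝓘(ℝ, F) M | p.proj ∈ e.source})
  refine (h3.prodMk_space h2).congr fun p hp ↦ Prod.ext rfl ?_
  exact congrArg (fun L ↦ L p.snd) (mfderivWithin_of_isOpen (I := 𝓘(ℝ, F)) (I' := 𝓘(ℝ, F)) (f := e)
    e.open_source hp).symm

theorem contMDiff_tangentBundle_mk :
    ContMDiff 𝓘(ℝ, F × F) 𝓘(ℝ, F).tangent ∞
      (fun q : F × F ↦ (⟨q.1, q.2⟩ : TangentBundle 𝓘(ℝ, F) F)) := by
  have := contMDiff_tangentBundleModelSpaceHomeomorph_symm (I := 𝓘(ℝ, F)) (n := ∞)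
  rw [modelWithCornersSelf_prod]
  exact this

theorem contMDiffOn_tangentOfCoord (he : e ∈ IsManifold.maximalAtlas 𝓘(ℝ, F) ∞ M) :
    ContMDiffOn 𝓘(ℝ, F × F) 𝓘(ℝ, F).tangent ∞ (tangentOfCoord (M := M) e)
      {q | q.1 ∈ e.target} := by
  have h1 : ContMDiffOn 𝓘(ℝ, F).tangent 𝓘(ℝ, F).tangent ∞
      (tangentMapWithin 𝓘(ℝ, F) 𝓘(ℝ, F) e.symm e.target)
      {p : TangentBundle 𝓘(ℝ, F) F | p.proj ∈ e.target} :=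
    (contMDiffOn_symm_of_mem_maximalAtlas he).contMDiffOn_tangentMapWithin (by simp)
      e.open_target.uniqueMDiffOn
  refine (h1.comp contMDiff_tangentBundle_mk.contMDiffOn (fun q hq ↦ hq)).congr fun q hq ↦ ?_
  refine tangentBundle_mk_congr rfl ?_
  exact congrArg (fun L ↦ L q.2) (mfderivWithin_of_isOpen (I := 𝓘(ℝ, F)) (I' := 𝓘(ℝ, F)) (f := e.symm)
    e.open_target hq).symm

variable {X : (p : TangentBundle 𝓘(ℝ, F) M) → TangentSpace 𝓘(ℝ, F).tangent p}

theorem mdifferentiableAt_tangentCoord (he : e ∈ IsManifold.maximalAtlas 𝓘(ℝ, F) ∞ M)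
    {p : TangentBundle 𝓘(ℝ, F) M} (hp : p.proj ∈ e.source) :
    MDifferentiableAt 𝓘(ℝ, F).tangent 𝓘(ℝ, F × F) (tangentCoord e) p :=
  ((contMDiffOn_tangentCoord he).contMDiffAt
    ((isOpen_proj_preimage_source e).mem_nhds hp)).mdifferentiableAt (by simp)

theorem mdifferentiableAt_tangentOfCoord (he : e ∈ IsManifold.maximalAtlas 𝓘(ℝ, F) ∞ M)
    {q : F × F} (hq : q.1 ∈ e.target) :
    MDifferentiableAt 𝓘(ℝ, F × F) 𝓘(ℝ, F).tangent (tangentOfCoord (M := M) e) q :=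
  ((contMDiffOn_tangentOfCoord he).contMDiffAt
    ((e.open_target.preimage continuous_fst).mem_nhds hq)).mdifferentiableAt (by simp)

theorem hasDerivAt_tangentCoord_comp (he : e ∈ IsManifold.maximalAtlas 𝓘(ℝ, F) ∞ M)
    {γ : ℝ → TangentBundle 𝓘(ℝ, F) M} {t : ℝ}
    (hγ : HasMFDerivAt 𝓘(ℝ, ℝ) 𝓘(ℝ, F).tangent γ t ((1 : ℝ →L[ℝ] ℝ).smulRight (X (γ t))))
    (ht : (γ t).proj ∈ e.source) :
    HasDerivAt (fun s ↦ tangentCoord e (γ s)) (vectorFieldCoord X e (tangentCoord e (γ t))) t := by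
  obtain ⟨L, hL, hL'⟩ : ∃ L : ℝ →L[ℝ] F × F, HasFDerivAt (fun s ↦ tangentCoord e (γ s)) L t ∧
      L 1 = mfderiv 𝓘(ℝ, F).tangent 𝓘(ℝ, F × F) (tangentCoord e) (γ t)
        (((1 : ℝ →L[ℝ] ℝ).smulRight (X (γ t))) (1 : ℝ)) :=
    ⟨_, ((mdifferentiableAt_tangentCoord he ht).hasMFDerivAt.comp t hγ).hasFDerivAt, rfl⟩
  have h1 : vectorFieldCoord X e (tangentCoord e (γ t)) = L 1 := by
    rw [hL', vectorFieldCoord, tangentOfCoord_tangentCoord he ht]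
    exact congrArg _ (one_smul ℝ (X (γ t))).symm
  rw [h1]
  exact hL.hasDerivAt

/-- `tangentOfCoord` and `tangentCoord` are local inverses, so their differentials compose to the
identity. This lets a solution of the coordinate ODE be lifted back to an integral curve in the
tangent bundle. -/
theorem mfderiv_tangentOfCoord_vectorFieldCoord (he : e ∈ IsManifold.maximalAtlas 𝓘(ℝ, F) ∞ M)
    {q : F × F} (hq : q.1 ∈ e.target) :
    mfderiv 𝓘(ℝ, F × F) 𝓘(ℝ, F).tangent (tangentOfCoord (M := M) e) q (vectorFieldCoord X e q) =
      X (tangentOfCoord e q) := by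
  set p := tangentOfCoord (M := M) e q with hp
  have hps : p.proj ∈ e.source := e.map_target hq
  have hqp : tangentCoord e p = q := tangentCoord_tangentOfCoord he hq
  have h1 : mfderiv 𝓘(ℝ, F).tangent 𝓘(ℝ, F).tangent (tangentOfCoord e ∘ tangentCoord e) p =
      ContinuousLinearMap.id ℝ _ := by
    have : tangentOfCoord e ∘ tangentCoord e =ᶠ[𝓝 p] id := by
      filter_upwards [(isOpen_proj_preimage_source e).mem_nhds hps] with p' hp'
      exact tangentOfCoord_tangentCoord he hp'
    rw [this.mfderiv_eq]
    exact mfderiv_id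
  have h2 := mfderiv_comp p (g := tangentOfCoord e) (f := tangentCoord e)
    (mdifferentiableAt_tangentOfCoord (M := M) he (by rwa [hqp]))
    (mdifferentiableAt_tangentCoord he hps)
  have h3 := congrArg (fun L ↦ L (X p)) (h2.symm.trans h1)
  have key : ∀ q' : F × F, q' = q → ∀ u : F × F,
      (mfderiv 𝓘(ℝ, F × F) 𝓘(ℝ, F).tangent (tangentOfCoord (M := M) e) q' u : F × F) =
      mfderiv 𝓘(ℝ, F × F) 𝓘(ℝ, F).tangent (tangentOfCoord (M := M) e) q u := by
    rintro _ rfl _; rfl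
  exact (key _ hqp _).symm.trans h3

theorem hasMFDerivAt_tangentOfCoord_comp (he : e ∈ IsManifold.maximalAtlas 𝓘(ℝ, F) ∞ M)
    {q : ℝ → F × F} {t : ℝ} (hq : HasDerivAt q (vectorFieldCoord X e (q t)) t)
    (ht : (q t).1 ∈ e.target) :
    HasMFDerivAt 𝓘(ℝ, ℝ) 𝓘(ℝ, F).tangent (fun s ↦ tangentOfCoord (M := M) e (q s)) t
      ((1 : ℝ →L[ℝ] ℝ).smulRight (X (tangentOfCoord e (q t)))) := by
  have h := (mdifferentiableAt_tangentOfCoord he ht).hasMFDerivAt.comp t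
    hq.hasFDerivAt.hasMFDerivAt
  refine h.congr_mfderiv ?_
  refine ContinuousLinearMap.ext_ring ?_
  refine Eq.trans (congrArg (mfderiv 𝓘(ℝ, F × F) 𝓘(ℝ, F).tangent (tangentOfCoord (M := M) e) (q t))
    (one_smul ℝ (vectorFieldCoord X e (q t)))) ?_
  exact (mfderiv_tangentOfCoord_vectorFieldCoord he ht).trans (one_smul ℝ _).symm

end TangentCoord

/-! ### Sprays in coordinates. -/

section SprayCoord

variable {F M : Type*} [NormedAddCommGroup F] [NormedSpace ℝ F]
  [TopologicalSpace M] [ChartedSpace F M]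

theorem velocityLift_comp {φ : M → M} {c : ℝ → M} {t : ℝ}
    (hφ : MDifferentiableAt 𝓘(ℝ, F) 𝓘(ℝ, F) φ (c t))
    (hc : MDifferentiableAt 𝓘(ℝ, ℝ) 𝓘(ℝ, F) c t) :
    velocityLift F (fun s ↦ φ (c s)) t = tangentMap 𝓘(ℝ, F) 𝓘(ℝ, F) φ (velocityLift F c t) := by
  refine tangentBundle_mk_congr rfl ?_
  exact congrArg (fun L ↦ L (1 : ℝ)) (mfderiv_comp t hφ hc)

variable [IsManifold 𝓘(ℝ, F) ∞ M] {e : OpenPartialHomeomorph M F}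

namespace Spray

variable (S : Spray F M)

/-- The coordinate form is a composition of smooth maps: `tangentOfCoord`, the spray as a section
over the slit bundle, the tangent map of `tangentCoord`, and the projection to the fibre. A nonzero
coordinate vector keeps the first map inside the slit bundle. -/
theorem contDiffAt_vectorFieldCoord (he : e ∈ IsManifold.maximalAtlas 𝓘(ℝ, F) ∞ M)
    {q : F × F} (hq : q.1 ∈ e.target) (hq' : q.2 ≠ 0) :
    ContDiffAt ℝ ∞ (vectorFieldCoord S.toFun e) q := by
  set U : Set (TangentBundle 𝓘(ℝ, F) M) := {p | p.proj ∈ e.source} with hU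
  have hUo : IsOpen U := isOpen_proj_preimage_source e
  set D : Set (F × F) := {q | q.1 ∈ e.target ∧ q.2 ≠ 0} with hD
  have hDo : IsOpen D := (e.open_target.preimage continuous_fst).inter
    (isOpen_ne.preimage continuous_snd)
  have h1 : ContMDiffOn 𝓘(ℝ, F × F) 𝓘(ℝ, F).tangent ∞ (tangentOfCoord (M := M) e) D :=
    (contMDiffOn_tangentOfCoord he).mono fun q hq ↦ hq.1
  have h2 : MapsTo (tangentOfCoord (M := M) e) D (slitTangentBundle F M) := by
    intro q hq h0
    have h3 : (tangentOfCoord (M := M) e q).proj ∈ e.source := e.map_target hq.1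
    have h4 := (tangentCoord_snd_eq_zero_iff he h3).2 h0
    rw [tangentCoord_tangentOfCoord he hq.1] at h4
    exact hq.2 h4
  have h3 := S.contMDiffOn_toFun.comp h1 h2
  have h4 := (contMDiffOn_tangentCoord (M := M) he).contMDiffOn_tangentMapWithin (m := ∞)
    (by simp) hUo.uniqueMDiffOn
  have h5 := h4.comp h3 (fun q hq ↦ e.map_target hq.1)
  have h6 := (contMDiff_snd_tangentBundle_modelSpace (F × F) 𝓘(ℝ, F × F) (n := ∞)).comp_contMDiffOn
    h5
  have h7 : ContMDiffOn 𝓘(ℝ, F × F) 𝓘(ℝ, F × F) ∞ (vectorFieldCoord S.toFun e) D := by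
    refine h6.congr fun q hq ↦ ?_
    exact congrArg (fun L ↦ L (S.toFun (tangentOfCoord e q)))
      (mfderivWithin_of_isOpen (I := 𝓘(ℝ, F).tangent) (I' := 𝓘(ℝ, F × F)) (f := tangentCoord e)
        hUo (e.map_target hq.1)).symm
  exact (h7.contMDiffAt (hDo.mem_nhds ⟨hq, hq'⟩)).contDiffAt

theorem contDiffAt_coeff (he : e ∈ IsManifold.maximalAtlas 𝓘(ℝ, F) ∞ M)
    {x y : F} (hx : x ∈ e.target) (hy : y ≠ 0) :
    ContDiffAt ℝ ∞ (fun q : F × F ↦ S.coeff e q.1 q.2) (x, y) :=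
  contDiffAt_const.smul (S.contDiffAt_vectorFieldCoord he (q := (x, y)) hx hy).snd

theorem hasFDerivAt_coeff (he : e ∈ IsManifold.maximalAtlas 𝓘(ℝ, F) ∞ M)
    {x y : F} (hx : x ∈ e.target) (hy : y ≠ 0) :
    HasFDerivAt (fun y' ↦ S.coeff e x y') (S.connCoeff e x y) y := by
  have h := ((S.contDiffAt_coeff he hx hy).differentiableAt (by simp)).comp y
    (f := fun y' ↦ (x, y')) (by fun_prop)
  exact h.hasFDerivAt

theorem vectorFieldCoord_eq (he : e ∈ IsManifold.maximalAtlas 𝓘(ℝ, F) ∞ M)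
    {x y : F} (hx : x ∈ e.target) (hy : y ≠ 0) :
    vectorFieldCoord S.toFun e (x, y) = (y, -(2 : ℝ) • S.coeff e x y) := by
  refine Prod.ext (S.coord_fst e he x hx y hy) ?_
  simp [coeff, smul_smul]

/-- In a chart, a curve whose canonical lift is tangent to the spray solves the geodesic
equation. -/
theorem hasDerivAt_tangentCoord_velocityLift (he : e ∈ IsManifold.maximalAtlas 𝓘(ℝ, F) ∞ M)
    {c : ℝ → M} {t : ℝ} (ht : c t ∈ e.source) (hv : velocity (F := F) c t ≠ 0)
    (hc : HasMFDerivAt 𝓘(ℝ, ℝ) 𝓘(ℝ, F).tangent (velocityLift F c) t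
      ((1 : ℝ →L[ℝ] ℝ).smulRight (S.toFun (velocityLift F c t)))) :
    HasDerivAt (fun s ↦ (tangentCoord e (velocityLift F c s)).2)
      (-(2 : ℝ) • S.coeff e (e (c t)) (tangentCoord e (velocityLift F c t)).2) t := by
  have h := hasDerivAt_tangentCoord_comp he hc ht
  have hne : (tangentCoord e (velocityLift F c t)).2 ≠ 0 := by
    rwa [Ne, tangentCoord_snd_eq_zero_iff he ht]
  have h2 := S.vectorFieldCoord_eq he (e.map_source ht) hne
  have h3 : tangentCoord e (velocityLift F c t) =
    (e (c t), (tangentCoord e (velocityLift F c t)).2) := rfl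
  rw [h3, h2] at h
  exact h.snd

/-- Invariance of the equation of geodesics under a map preserving the spray. -/
theorem hasMFDerivAt_velocityLift_comp {φ : M → M} (hφ : ContMDiff 𝓘(ℝ, F) 𝓘(ℝ, F) ∞ φ)
    (hS : ∀ p ∈ slitTangentBundle F M,
      mfderiv 𝓘(ℝ, F).tangent 𝓘(ℝ, F).tangent (tangentMap 𝓘(ℝ, F) 𝓘(ℝ, F) φ) p (S.toFun p) =
        S.toFun (tangentMap 𝓘(ℝ, F) 𝓘(ℝ, F) φ p))
    {c : ℝ → M} {t : ℝ} (hd : ∀ᶠ s in 𝓝 t, MDifferentiableAt 𝓘(ℝ, ℝ) 𝓘(ℝ, F) c s)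
    (hv : velocity (F := F) c t ≠ 0)
    (hc : HasMFDerivAt 𝓘(ℝ, ℝ) 𝓘(ℝ, F).tangent (velocityLift F c) t
      ((1 : ℝ →L[ℝ] ℝ).smulRight (S.toFun (velocityLift F c t)))) :
    HasMFDerivAt 𝓘(ℝ, ℝ) 𝓘(ℝ, F).tangent (velocityLift F fun s ↦ φ (c s)) t
      ((1 : ℝ →L[ℝ] ℝ).smulRight (S.toFun (velocityLift F (fun s ↦ φ (c s)) t))) := by
  have hT : MDifferentiableAt 𝓘(ℝ, F).tangent 𝓘(ℝ, F).tangent (tangentMap 𝓘(ℝ, F) 𝓘(ℝ, F) φ)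
      (velocityLift F c t) :=
    (hφ.contMDiff_tangentMap (m := ∞) (by simp)).mdifferentiable (by simp) _
  have hlift : ∀ᶠ s in 𝓝 t, velocityLift F (fun s ↦ φ (c s)) s =
      tangentMap 𝓘(ℝ, F) 𝓘(ℝ, F) φ (velocityLift F c s) :=
    hd.mono fun s hs ↦ velocityLift_comp (hφ.mdifferentiable (by simp) _) hs
  have h := (hT.hasMFDerivAt.comp t hc).congr_of_eventuallyEq hlift
  have key : ∀ p q : TangentBundle 𝓘(ℝ, F) M, p = q → ∀ u : F × F, u = S.toFun q →
      (S.toFun p : F × F) = u := by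
    rintro p _ rfl u hu; exact hu.symm
  refine h.congr_mfderiv ?_
  refine ContinuousLinearMap.ext_ring ?_
  refine Eq.trans (congrArg (mfderiv 𝓘(ℝ, F).tangent 𝓘(ℝ, F).tangent
    (tangentMap 𝓘(ℝ, F) 𝓘(ℝ, F) φ) (velocityLift F c t))
    (one_smul ℝ (S.toFun (velocityLift F c t)))) ?_
  refine Eq.trans ?_ (one_smul ℝ (S.toFun (velocityLift F (fun s ↦ φ (c s)) t))).symm
  exact (key _ _ hlift.self_of_nhds _ (hS _ hv)).symm

end Spray

end SprayCoord

/-! ### Local normal form and local sections of submersions. -/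

section Submersion

variable {E F M N : Type*} [NormedAddCommGroup E] [NormedSpace ℝ E]
  [NormedAddCommGroup F] [NormedSpace ℝ F] [TopologicalSpace M] [ChartedSpace E M]
  [TopologicalSpace N] [ChartedSpace F N] {f : M → N}

/-- In suitable charts, a submersion is a linear map which has a right inverse. -/
theorem exists_charts_of_isSubmersionAt {a : M}
    (hf : Manifold.IsSubmersionAt 𝓘(ℝ, E) 𝓘(ℝ, F) ∞ f a) :
    ∃ φ ∈ IsManifold.maximalAtlas 𝓘(ℝ, E) ∞ M, ∃ ψ ∈ IsManifold.maximalAtlas 𝓘(ℝ, F) ∞ N,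
      a ∈ φ.source ∧ MapsTo f φ.source ψ.source ∧
      ∃ (P : E →L[ℝ] F) (R : F →L[ℝ] E), (∀ u, P (R u) = u) ∧
        ∀ b ∈ φ.source, ψ (f b) = P (φ b) := by
  refine ⟨hf.domChart, hf.domChart_mem_maximalAtlas, hf.codChart, hf.codChart_mem_maximalAtlas,
    hf.mem_domChart_source, hf.source_subset_preimage_source,
    (ContinuousLinearMap.fst ℝ F hf.complement).comp hf.equiv.toContinuousLinearMap,
    hf.equiv.symm.toContinuousLinearMap.comp (ContinuousLinearMap.inl ℝ F hf.complement),
    fun u ↦ by simp, fun b hb ↦ ?_⟩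
  have h := hf.writtenInCharts (show hf.domChart b ∈ (hf.domChart.extend 𝓘(ℝ, E)).target by
    simpa using hf.domChart.map_source hb)
  simpa [hf.domChart.left_inv hb] using h

/-- In submersion charts `f` is a linear map `P` with right inverse `R`, and the affine map `x ↦ φ a
+ R (ψ x - ψ (f a))` is a section. -/
theorem exists_section_of_isSubmersionAt [IsManifold 𝓘(ℝ, E) ∞ M] [IsManifold 𝓘(ℝ, F) ∞ N] {a : M}
    (hf : Manifold.IsSubmersionAt 𝓘(ℝ, E) 𝓘(ℝ, F) ∞ f a) :
    ∃ σ : N → M, ContMDiffAt 𝓘(ℝ, F) 𝓘(ℝ, E) ∞ σ (f a) ∧ σ (f a) = a ∧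
      ∀ᶠ x in 𝓝 (f a), f (σ x) = x := by
  obtain ⟨φ, hφ, ψ, hψ, ha, hm, P, R, hPR, hP⟩ := exists_charts_of_isSubmersionAt hf
  let τ : N → E := fun x ↦ φ a + R (ψ x - ψ (f a))
  have e1 : τ (f a) = φ a := by simp [τ]
  have hτ : ContMDiffAt 𝓘(ℝ, F) 𝓘(ℝ, E) ∞ τ (f a) := by
    have h1 : ContDiff ℝ ∞ fun u : F ↦ φ a + R (u - ψ (f a)) := by fun_prop
    exact h1.contMDiff.contMDiffAt.comp (f a) (contMDiffAt_of_mem_maximalAtlas hψ (hm ha))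
  refine ⟨fun x ↦ φ.symm (τ x), ?_, by simp only [e1, φ.left_inv ha], ?_⟩
  · refine ContMDiffAt.comp (g := φ.symm) (f a) ?_ hτ
    rw [e1]
    exact contMDiffAt_symm_of_mem_maximalAtlas hφ (φ.map_source ha)
  · have h1 : ∀ᶠ x in 𝓝 (f a), τ x ∈ φ.target :=
      hτ.continuousAt.eventually_mem (φ.open_target.mem_nhds (by rw [e1]; exact φ.map_source ha))
    filter_upwards [h1, ψ.open_source.mem_nhds (hm ha)] with x hx hx'
    refine ψ.injOn (hm (φ.map_target hx)) hx' ?_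
    rw [hP _ (φ.map_target hx), φ.right_inv hx]
    simp [τ, hPR, hP a ha]

end Submersion

/-! ### The projection to the coset space: smooth action, surjectivity and kernel of its
differential. -/

section CosetSpace

variable {E F G : Type*} [NormedAddCommGroup E] [NormedSpace ℝ E]
  [NormedAddCommGroup F] [NormedSpace ℝ F]
  [Group G] [TopologicalSpace G] [ChartedSpace E G]
  {H : Subgroup G} [ChartedSpace F (G ⧸ H)]

variable (H) in
/-- The coordinate representation `e ∘ π : G → F` of the projection `π : G → G/H`. -/
def projCoord (e : OpenPartialHomeomorph (G ⧸ H) F) (a : G) : F := e (a : G ⧸ H)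

variable {e : OpenPartialHomeomorph (G ⧸ H) F}

theorem contMDiffAt_projCoord
    (hπ : Manifold.IsSubmersion 𝓘(ℝ, E) 𝓘(ℝ, F) ∞ (fun a : G ↦ (a : G ⧸ H)))
    (he : e ∈ IsManifold.maximalAtlas 𝓘(ℝ, F) ∞ (G ⧸ H)) {g : G} (hg : (g : G ⧸ H) ∈ e.source) :
    ContMDiffAt 𝓘(ℝ, E) 𝓘(ℝ, F) ∞ (projCoord H e) g :=
  (contMDiffAt_of_mem_maximalAtlas he hg).comp g hπ.contMDiff.contMDiffAt

theorem mdifferentiableAt_projCoord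
    (hπ : Manifold.IsSubmersion 𝓘(ℝ, E) 𝓘(ℝ, F) ∞ (fun a : G ↦ (a : G ⧸ H)))
    (he : e ∈ IsManifold.maximalAtlas 𝓘(ℝ, F) ∞ (G ⧸ H)) {g : G} (hg : (g : G ⧸ H) ∈ e.source) :
    MDifferentiableAt 𝓘(ℝ, E) 𝓘(ℝ, F) (projCoord H e) g :=
  (contMDiffAt_projCoord hπ he hg).mdifferentiableAt (by simp)

theorem cosetPush_proj (g : G) (v : GroupLieAlgebra 𝓘(ℝ, E) G) :
    (cosetPush E F H g v).proj = (g : G ⧸ H) :=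
  congrArg (fun a : G ↦ (a : G ⧸ H)) (mul_one g)

variable [LieGroup 𝓘(ℝ, E) ∞ G] [IsManifold 𝓘(ℝ, F) ∞ (G ⧸ H)]

/-- Near a given point the action of `g` is `π ∘ L_g ∘ σ` for a local section `σ` of the projection.
-/
theorem contMDiff_coset_smul
    (hπ : Manifold.IsSubmersion 𝓘(ℝ, E) 𝓘(ℝ, F) ∞ (fun a : G ↦ (a : G ⧸ H))) (g : G) :
    ContMDiff 𝓘(ℝ, F) 𝓘(ℝ, F) ∞ (fun x : G ⧸ H ↦ g • x) := by
  intro x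
  obtain ⟨a, rfl⟩ := QuotientGroup.mk_surjective x
  obtain ⟨σ, hσ, -, hσ'⟩ := exists_section_of_isSubmersionAt (hπ.isSubmersionAt a)
  have h1 : ContMDiffAt 𝓘(ℝ, F) 𝓘(ℝ, F) ∞ (fun x ↦ ((g * σ x : G) : G ⧸ H)) (a : G ⧸ H) :=
    hπ.contMDiff.contMDiffAt.comp _ ((contMDiff_mul_left (I := 𝓘(ℝ, E)) (n := ∞)
      (a := g)).contMDiffAt.comp _ hσ)
  refine h1.congr_of_eventuallyEq ?_
  filter_upwards [hσ'] with x hx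
  conv_lhs => rw [← hx]
  rfl

theorem tangentCoord_cosetPush_snd
    (hπ : Manifold.IsSubmersion 𝓘(ℝ, E) 𝓘(ℝ, F) ∞ (fun a : G ↦ (a : G ⧸ H)))
    (he : e ∈ IsManifold.maximalAtlas 𝓘(ℝ, F) ∞ (G ⧸ H)) {g : G} (hg : (g : G ⧸ H) ∈ e.source)
    (v : GroupLieAlgebra 𝓘(ℝ, E) G) :
    (tangentCoord e (cosetPush E F H g v)).2 = leftDeriv E (projCoord H e) g v := by
  refine Eq.trans ?_ (mfderiv_comp_mul_left (mdifferentiableAt_projCoord hπ he hg) v)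
  have hg' : g • ((1 : G) : G ⧸ H) ∈ e.source := by
    have : g • ((1 : G) : G ⧸ H) = (g : G ⧸ H) := cosetPush_proj (F := F) (H := H) g v
    rwa [this]
  have h1 := (contMDiff_coset_smul hπ g).mdifferentiable (by simp) ((1 : G) : G ⧸ H)
  have h2 := hπ.contMDiff.mdifferentiable (by simp) (1 : G)
  have h3 := (mdifferentiable_of_mem_maximalAtlas he).mdifferentiableAt hg'
  have h4 := mfderiv_comp (1 : G) (f := fun a : G ↦ (a : G ⧸ H)) (g := fun x : G ⧸ H ↦ g • x) h1 h2
  have h5 := mfderiv_comp (1 : G) (g := e)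
    (f := (fun x : G ⧸ H ↦ g • x) ∘ fun a : G ↦ (a : G ⧸ H)) h3 (h1.comp _ h2)
  have h6 := congrArg (fun L ↦ L v) h5
  refine Eq.trans ?_ h6.symm
  exact (congrArg (fun L ↦ mfderiv 𝓘(ℝ, F) 𝓘(ℝ, F) e (g • ((1 : G) : G ⧸ H)) (L v)) h4).symm

/-- The derivatives of the coordinate representations of `G → G/H` at two points differ by a linear
map of the target. -/
theorem exists_leftDeriv_projCoord_eq_comp
    (hπ : Manifold.IsSubmersion 𝓘(ℝ, E) 𝓘(ℝ, F) ∞ (fun a : G ↦ (a : G ⧸ H)))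
    {e e' : OpenPartialHomeomorph (G ⧸ H) F} (he : e ∈ IsManifold.maximalAtlas 𝓘(ℝ, F) ∞ (G ⧸ H))
    (he' : e' ∈ IsManifold.maximalAtlas 𝓘(ℝ, F) ∞ (G ⧸ H)) {g g' : G}
    (hg : (g : G ⧸ H) ∈ e.source) (hg' : (g' : G ⧸ H) ∈ e'.source) :
    ∃ T : F →L[ℝ] F, leftDeriv E (projCoord H e') g' = T.comp (leftDeriv E (projCoord H e) g) := by
  -- The action of `g' g⁻¹` in coordinates. It carries the coset of `g` to that of `g'`, and its
  -- differential is the required linear map.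
  let k : F → F := fun u ↦ e' ((g' * g⁻¹) • e.symm u)
  have hk : DifferentiableAt ℝ k (projCoord H e g) := by
    have h1 : e.symm (projCoord H e g) = (g : G ⧸ H) := e.left_inv hg
    have h2 : (g' * g⁻¹) • (g : G ⧸ H) = (g' : G ⧸ H) :=
      congrArg (fun a : G ↦ (a : G ⧸ H)) (inv_mul_cancel_right g' g)
    refine mdifferentiableAt_iff_differentiableAt.1 (MDifferentiableAt.comp (g := e') _ ?_
      (((contMDiff_coset_smul hπ (g' * g⁻¹)).mdifferentiable (by simp) _).comp _
        ((mdifferentiable_of_mem_maximalAtlas he).mdifferentiableAt_symm (e.map_source hg))))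
    refine (mdifferentiable_of_mem_maximalAtlas he').mdifferentiableAt ?_
    rwa [h1, h2]
  refine ⟨fderiv ℝ k (projCoord H e g), ?_⟩
  rw [← leftDeriv_comp (mdifferentiableAt_projCoord hπ he hg) hk]
  have : ContinuousMul G := (topologicalGroup_of_lieGroup 𝓘(ℝ, E) ∞).toContinuousMul
  have h1 : (fun a ↦ k (projCoord H e a)) =ᶠ[𝓝 g] fun a ↦ projCoord H e' (g' * g⁻¹ * a) := by
    have hc : ContinuousAt (fun a : G ↦ (a : G ⧸ H)) g := hπ.contMDiff.continuous.continuousAt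
    filter_upwards [hc.eventually_mem (e.open_source.mem_nhds hg)] with a ha
    simp only [k, projCoord, e.left_inv ha]
    rfl
  rw [leftDeriv_congr h1, leftDeriv_comp_mul_left, inv_mul_cancel_right]

/-- A curve inside `H` projects to a constant, which settles the claim at `1`; a linear map of the
target then transfers it to `g`. -/
theorem leftDeriv_projCoord_apply_eq_zero
    (hπ : Manifold.IsSubmersion 𝓘(ℝ, E) 𝓘(ℝ, F) ∞ (fun a : G ↦ (a : G ⧸ H)))
    (he : e ∈ IsManifold.maximalAtlas 𝓘(ℝ, F) ∞ (G ⧸ H)) {g : G} (hg : (g : G ⧸ H) ∈ e.source)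
    {v : GroupLieAlgebra 𝓘(ℝ, E) G} (hv : v ∈ subgroupLieAlgebra E H) :
    leftDeriv E (projCoord H e) g v = 0 := by
  obtain ⟨γ, hγ, hγH, hγv⟩ := hv
  set e₁ := chartAt F ((1 : G) : G ⧸ H)
  have he₁ : e₁ ∈ IsManifold.maximalAtlas 𝓘(ℝ, F) ∞ (G ⧸ H) := IsManifold.chart_mem_maximalAtlas _
  have hd := mdifferentiableAt_projCoord hπ he₁ (g := 1) (mem_chart_source F _)
  obtain ⟨T, hT⟩ := exists_leftDeriv_projCoord_eq_comp hπ he₁ he (g := 1) (mem_chart_source F _) hg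
  have h0 : γ 0 = 1 := congrArg TotalSpace.proj hγv
  have hd' : MDifferentiableAt 𝓘(ℝ, E) 𝓘(ℝ, F) (projCoord H e₁) (γ 0) := by rwa [h0]
  have h1 : (mfderiv 𝓘(ℝ, E) 𝓘(ℝ, F) (projCoord H e₁) (γ 0) (velocity γ 0) : F) =
      mfderiv 𝓘(ℝ, E) 𝓘(ℝ, F) (projCoord H e₁) 1 v :=
    congrArg (fun p : TangentBundle 𝓘(ℝ, E) G ↦
      (mfderiv 𝓘(ℝ, E) 𝓘(ℝ, F) (projCoord H e₁) p.proj p.snd : F)) hγv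
  obtain ⟨L, hL, hL'⟩ : ∃ L : ℝ →L[ℝ] F, HasFDerivAt (fun s ↦ projCoord H e₁ (γ s)) L 0 ∧
      L 1 = mfderiv 𝓘(ℝ, E) 𝓘(ℝ, F) (projCoord H e₁) (γ 0) (velocity γ 0) :=
    ⟨_, (hd'.hasMFDerivAt.comp 0
      (hγ.mdifferentiable (by simp) 0).hasMFDerivAt).hasFDerivAt, rfl⟩
  have h2 : (fun s ↦ projCoord H e₁ (γ s)) = fun _ ↦ projCoord H e₁ 1 := by
    funext s
    refine congrArg e₁ (QuotientGroup.eq.2 ?_)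
    simpa using hγH s
  rw [h2] at hL
  have h3 : L 1 = 0 := by rw [hL.unique (hasFDerivAt_const _ _)]; rfl
  have h4 := mfderiv_one hd v
  have h5 : leftDeriv E (projCoord H e₁) 1 v = 0 :=
    h4.symm.trans (h1.symm.trans (hL'.symm.trans h3))
  exact (congrArg (fun L : E →L[ℝ] F ↦ L v) hT).trans ((congrArg T h5).trans (map_zero T))

variable [FiniteDimensional ℝ E]

/-- The differential of the transition from `φ` to the preferred chart is a left inverse, and an
injective endomorphism of a finite-dimensional space is onto. -/
theorem leftDeriv_bijective {φ : OpenPartialHomeomorph G E}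
    (hφ : φ ∈ IsManifold.maximalAtlas 𝓘(ℝ, E) ∞ G) (h1 : (1 : G) ∈ φ.source) :
    Function.Bijective (leftDeriv E φ 1) := by
  have : ContinuousMul G := (topologicalGroup_of_lieGroup 𝓘(ℝ, E) ∞).toContinuousMul
  have hinj : Function.Injective (leftDeriv E φ 1) := by
    have h2 := (mdifferentiable_of_mem_maximalAtlas hφ).mdifferentiableAt h1
    have h3 : DifferentiableAt ℝ (fun x ↦ chartAt E (1 : G) (φ.symm x)) (φ 1) := by
      refine mdifferentiableAt_iff_differentiableAt.1 (MDifferentiableAt.comp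
        (g := chartAt E (1 : G)) _ (mdifferentiableAt_chartAt_one ?_)
        ((mdifferentiable_of_mem_maximalAtlas hφ).mdifferentiableAt_symm (φ.map_source h1)))
      rw [φ.left_inv h1]
      exact mem_chart_source E 1
    have h4 := leftDeriv_comp h2 h3
    have h5 : (fun a ↦ chartAt E (1 : G) (φ.symm (φ a))) =ᶠ[𝓝 1] chartAt E (1 : G) := by
      filter_upwards [φ.open_source.mem_nhds h1] with a ha
      rw [φ.left_inv ha]
    rw [leftDeriv_congr h5, leftDeriv_chartAt_one] at h4
    intro v w hvw
    have h6 := fun u ↦ congrArg (fun L : E →L[ℝ] E ↦ L u) h4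
    simp only [ContinuousLinearMap.id_apply, ContinuousLinearMap.comp_apply] at h6
    rw [h6 v, h6 w, hvw]
  exact ⟨hinj, LinearMap.surjective_of_injective (f := (leftDeriv E φ 1).toLinearMap) hinj⟩

/-- Both claims are read off at `1` in submersion charts, where the projection is linear, and
carried to `g` by linear maps `T`, `T'` of the target. A kernel vector moves along the linear fibre
through `1`, that is, inside `H`, and so is the velocity of a curve in `H`. -/
theorem leftDeriv_projCoord_surjective_and_ker
    (hπ : Manifold.IsSubmersion 𝓘(ℝ, E) 𝓘(ℝ, F) ∞ (fun a : G ↦ (a : G ⧸ H)))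
    [FiniteDimensional ℝ F]
    (he : e ∈ IsManifold.maximalAtlas 𝓘(ℝ, F) ∞ (G ⧸ H)) {g : G} (hg : (g : G ⧸ H) ∈ e.source) :
    Function.Surjective (leftDeriv E (projCoord H e) g) ∧
    ∀ v : GroupLieAlgebra 𝓘(ℝ, E) G, leftDeriv E (projCoord H e) g v = 0 →
      v ∈ subgroupLieAlgebra E H := by
  have : ContinuousMul G := (topologicalGroup_of_lieGroup 𝓘(ℝ, E) ∞).toContinuousMul
  obtain ⟨φ, hφ, ψ, hψ, ha, hm, P, R, hPR, hP⟩ :=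
    exists_charts_of_isSubmersionAt (hπ.isSubmersionAt 1)
  have h1 : leftDeriv E (projCoord H ψ) 1 = P.comp (leftDeriv E φ 1) := by
    have h2 : projCoord H ψ =ᶠ[𝓝 1] fun a ↦ P (φ a) := by
      filter_upwards [φ.open_source.mem_nhds ha] with a ha using hP a ha
    rw [leftDeriv_congr h2, leftDeriv_comp
      ((mdifferentiable_of_mem_maximalAtlas hφ).mdifferentiableAt ha) P.differentiableAt, P.fderiv]
  have hsurj : Function.Surjective (leftDeriv E (projCoord H ψ) 1) := by
    rw [h1]
    intro u
    obtain ⟨v, hv⟩ := (leftDeriv_bijective hφ ha).2 (R u)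
    exact ⟨v, by simp [hv, hPR]⟩
  obtain ⟨T, hT⟩ := exists_leftDeriv_projCoord_eq_comp hπ hψ he (hm ha) hg
  obtain ⟨T', hT'⟩ := exists_leftDeriv_projCoord_eq_comp hπ he hψ hg (hm ha)
  constructor
  · have hTT : ∀ u, T' (T u) = u := by
      intro u
      obtain ⟨v, rfl⟩ := hsurj u
      have h2 := congrArg (fun L : E →L[ℝ] F ↦ L v) hT'
      rw [hT] at h2
      exact h2.symm
    have hTs : Function.Surjective T := LinearMap.surjective_of_injective (f := T.toLinearMap)
      (Function.LeftInverse.injective hTT)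
    rw [hT]
    exact hTs.comp hsurj
  · intro v hv
    have hv1 : P (leftDeriv E φ 1 v) = 0 := by
      have h2 := congrArg (fun L : E →L[ℝ] F ↦ L v) (h1.symm.trans hT')
      exact h2.trans ((congrArg T' hv).trans (map_zero T'))
    set u : E := leftDeriv E φ 1 v with hu
    have hcont : ContinuousAt (fun s : ℝ ↦ φ 1 + s • u) 0 := by fun_prop
    have hmem : ∀ᶠ s : ℝ in 𝓝 0, φ 1 + s • u ∈ φ.target :=
      hcont.eventually_mem (φ.open_target.mem_nhds (by simpa using φ.map_source ha))
    obtain ⟨ε, hε, hball⟩ := Metric.eventually_nhds_iff.1 hmem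
    have hε2 : (ε / 2) ≠ 0 := by positivity
    -- Membership in `subgroupLieAlgebra` asks for a curve defined on all of `ℝ`. The sine keeps the
    -- parameter within `ε / 2` of zero, hence inside the chart, and has unit slope at `0`.
    let q : ℝ → E := fun t ↦ φ 1 + (ε / 2 * Real.sin (t / (ε / 2))) • u
    have hq : ∀ t, q t ∈ φ.target := by
      intro t
      refine hball ?_
      rw [Real.dist_eq, sub_zero, abs_mul, abs_of_pos (by positivity)]
      nlinarith [Real.abs_sin_le_one (t / (ε / 2))]
    have hqs : ContDiff ℝ ∞ q := by
      have : ContDiff ℝ ∞ fun t : ℝ ↦ Real.sin (t / (ε / 2)) :=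
        Real.contDiff_sin.comp (contDiff_id.div_const _)
      exact contDiff_const.add ((contDiff_const.mul this).smul contDiff_const)
    have hq' : HasDerivAt q u 0 := by
      have h2 : HasDerivAt (fun t : ℝ ↦ ε / 2 * Real.sin (t / (ε / 2)))
          (ε / 2 * (Real.cos (0 / (ε / 2)) * (1 / (ε / 2)))) 0 :=
        (((hasDerivAt_id (0 : ℝ)).div_const (ε / 2)).sin).const_mul (ε / 2)
      have h3 := (h2.smul_const u).const_add (φ 1)
      have h4 : ε / 2 * (Real.cos (0 / (ε / 2)) * (1 / (ε / 2))) = 1 := by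
        simp; field_simp
      rwa [h4, one_smul] at h3
    have hq0 : q 0 = φ 1 := by simp [q]
    have hγ : ContMDiff 𝓘(ℝ, ℝ) 𝓘(ℝ, E) ∞ (fun t ↦ φ.symm (q t)) := fun t ↦
      (contMDiffAt_symm_of_mem_maximalAtlas hφ (hq t)).comp t hqs.contMDiff.contMDiffAt
    refine ⟨fun t ↦ φ.symm (q t), hγ, fun t ↦ ?_, ?_⟩
    · have h2 : ((1 : G) : G ⧸ H) = (φ.symm (q t) : G) := by
        refine ψ.injOn (hm ha) (hm (φ.map_target (hq t))) ?_
        rw [hP 1 ha, hP _ (φ.map_target (hq t)), φ.right_inv (hq t)]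
        simp [q, hv1]
      simpa using QuotientGroup.eq.1 h2
    · have h0 : φ.symm (q 0) = 1 := by rw [hq0, φ.left_inv ha]
      have h0s : φ.symm (q 0) ∈ φ.source := φ.map_target (hq 0)
      refine tangentCoord_injOn hφ h0s ha ?_
      refine Prod.ext (congrArg φ h0) ?_
      have h2 := hasDerivAt_comp_velocity hφ (hγ.mdifferentiable (by simp) 0) h0s
      have h3 : (fun s ↦ φ (φ.symm (q s))) = q := funext fun s ↦ φ.right_inv (hq s)
      rw [h3] at h2
      have h4 := mfderiv_one ((mdifferentiable_of_mem_maximalAtlas hφ).mdifferentiableAt ha) v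
      exact (h2.unique hq').trans h4.symm

end CosetSpace

/-! ### Regularity of ODE solutions, complements of kernels, and derivatives in a subspace. -/

section Calculus

/-- Bootstrapping: if `α` is `C^n`, then so is `α' = Φ ∘ α`, and `α` is `C^(n+1)`. -/
theorem contDiffOn_of_hasDerivAt_comp {X : Type*} [NormedAddCommGroup X] [NormedSpace ℝ X]
    {Φ : X → X} {α : ℝ → X} {J : Set ℝ} (hJ : IsOpen J)
    (hα : ∀ t ∈ J, HasDerivAt α (Φ (α t)) t) (hΦ : ∀ t ∈ J, ContDiffAt ℝ ∞ Φ (α t)) :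
    ContDiffOn ℝ ∞ α J := by
  rw [contDiffOn_infty]
  intro n
  induction n with
  | zero =>
    exact contDiffOn_zero.2 fun t ht ↦ (hα t ht).continuousAt.continuousWithinAt
  | succ n ih =>
    refine (contDiffOn_succ_iff_deriv_of_isOpen (n := n) hJ).2
      ⟨fun t ht ↦ (hα t ht).differentiableAt.differentiableWithinAt, by simp, ?_⟩
    have h1 : ContDiffOn ℝ n (fun t ↦ Φ (α t)) J := fun t ht ↦
      ((hΦ t ht).of_le (mod_cast le_top)).comp_contDiffWithinAt t (ih t ht)
    exact h1.congr fun t ht ↦ (hα t ht).deriv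

/-- `A` restricts to an isomorphism from `𝔪` onto `F`. Its inverse is recorded twice: as `j`, a
continuous linear map into `E` suited to calculus, and as `k`, with values in `𝔪`. -/
theorem exists_linearMap_of_isCompl_ker {E F : Type*} [NormedAddCommGroup E] [NormedSpace ℝ E]
    [NormedAddCommGroup F] [NormedSpace ℝ F] [FiniteDimensional ℝ E] [FiniteDimensional ℝ F]
    {A : E →L[ℝ] F} {𝔥 𝔪 : Submodule ℝ E} (h : IsCompl 𝔥 𝔪) (hA : Function.Surjective A)
    (hker : ∀ v, A v = 0 ↔ v ∈ 𝔥) :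
    ∃ (j : F →L[ℝ] E) (k : F → 𝔪), (∀ u, (k u : E) = j u) ∧ (∀ u, A (j u) = u) ∧
      ∀ v : 𝔪, k (A v) = v := by
  have hinj : Function.Injective (A.toLinearMap.comp 𝔪.subtype) := by
    rw [injective_iff_map_eq_zero]
    intro v hv
    have h1 : (v : E) ∈ 𝔥 := (hker v).1 hv
    exact Subtype.ext ((Submodule.disjoint_def.1 h.disjoint) v h1 v.2)
  have hsurj : Function.Surjective (A.toLinearMap.comp 𝔪.subtype) := by
    intro u
    obtain ⟨x, rfl⟩ := hA u
    obtain ⟨a, ha, b, hb, rfl⟩ := Submodule.mem_sup.1 (h.sup_eq_top ▸ Submodule.mem_top : x ∈ 𝔥 ⊔ 𝔪)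
    exact ⟨⟨b, hb⟩, by simp [(hker a).2 ha]⟩
  let Q := LinearEquiv.ofBijective (A.toLinearMap.comp 𝔪.subtype) ⟨hinj, hsurj⟩
  exact ⟨𝔪.subtypeL.comp Q.symm.toLinearMap.toContinuousLinearMap, Q.symm, fun _ ↦ rfl,
    fun u ↦ Q.apply_symm_apply u,
    fun v ↦ Q.symm_apply_apply v⟩

theorem hasDerivAt_submodule_iff {E : Type*} [NormedAddCommGroup E] [NormedSpace ℝ E]
    {𝔪 : Submodule ℝ E} {y : ℝ → 𝔪} {v : 𝔪} {t : ℝ} :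
    HasDerivAt y v t ↔ HasDerivAt (fun s ↦ (y s : E)) (v : E) t := by
  rw [hasDerivAt_iff_isLittleO, hasDerivAt_iff_isLittleO, ← Asymptotics.isLittleO_norm_left,
    ← Asymptotics.isLittleO_norm_left (f' := fun x' ↦ (y x' : E) - y t - (x' - t) • (v : E))]
  rfl

theorem differentiableAt_submodule_and_deriv_eq {E : Type*} [NormedAddCommGroup E]
    [NormedSpace ℝ E] {𝔪 : Submodule ℝ E} {y : ℝ → 𝔪} {v : 𝔪} {t : ℝ}
    (h : HasDerivAt (fun s ↦ (y s : E)) (v : E) t) : DifferentiableAt ℝ y t ∧ deriv y t = v :=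
  ⟨(hasDerivAt_submodule_iff.2 h).differentiableAt, (hasDerivAt_submodule_iff.2 h).deriv⟩

theorem hasDerivAt_submodule_of_differentiableAt {E : Type*} [NormedAddCommGroup E]
    [NormedSpace ℝ E] {𝔪 : Submodule ℝ E} {y : ℝ → 𝔪} {t : ℝ} (h : DifferentiableAt ℝ y t) :
    HasDerivAt (fun s ↦ (y s : E)) ((deriv y t : 𝔪) : E) t :=
  hasDerivAt_submodule_iff.1 h.hasDerivAt

end Calculus

/-! ### Passage from a subspace of the Lie algebra to the model space, where derivatives are
computed. -/

section ModelVec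

variable {E F G : Type*} [NormedAddCommGroup E] [NormedSpace ℝ E]
  [NormedAddCommGroup F] [NormedSpace ℝ F]
  [Group G] [TopologicalSpace G] [ChartedSpace E G]
  {𝔪 : Submodule ℝ (GroupLieAlgebra 𝓘(ℝ, E) G)}

/-- An element of a subspace of the Lie algebra of `G`, as an element of the model space `E`. -/
def modelVec (v : 𝔪) : E := (v : GroupLieAlgebra 𝓘(ℝ, E) G)

theorem modelVec_add (v w : 𝔪) : modelVec (v + w) = modelVec v + modelVec w := rfl

theorem modelVec_sub (v w : 𝔪) : modelVec (v - w) = modelVec v - modelVec w := rfl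

theorem modelVec_neg (v : 𝔪) : modelVec (-v) = -modelVec v := rfl

theorem modelVec_smul (r : ℝ) (v : 𝔪) : modelVec (r • v) = r • modelVec v := rfl

theorem modelVec_zero : modelVec (0 : 𝔪) = 0 := rfl

theorem hasDerivAt_iff_modelVec {y : ℝ → 𝔪} {v : 𝔪} {t : ℝ} :
    HasDerivAt y v t ↔ HasDerivAt (fun s ↦ modelVec (y s)) (modelVec v) t :=
  hasDerivAt_submodule_iff (E := E) (𝔪 := 𝔪) (y := y) (v := v)

theorem exists_frame [FiniteDimensional ℝ E] [FiniteDimensional ℝ F]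
    {𝔥 : Submodule ℝ (GroupLieAlgebra 𝓘(ℝ, E) G)} (h : IsCompl 𝔥 𝔪) {A : E →L[ℝ] F}
    (hA : Function.Surjective A) (hker : ∀ v : GroupLieAlgebra 𝓘(ℝ, E) G, A v = 0 ↔ v ∈ 𝔥) :
    ∃ (j : F →L[ℝ] E) (k : F → 𝔪), (∀ u, modelVec (k u) = j u) ∧ (∀ u, A (j u) = u) ∧
      ∀ v : 𝔪, k (A (modelVec v)) = v :=
  exists_linearMap_of_isCompl_ker (E := E) (𝔥 := 𝔥) (𝔪 := 𝔪) h hA hker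

theorem deriv_eq_of_modelVec {y : ℝ → 𝔪} {v : 𝔪} {t : ℝ}
    (h : HasDerivAt (fun s ↦ modelVec (y s)) (modelVec v) t) :
    DifferentiableAt ℝ y t ∧ deriv y t = v :=
  differentiableAt_submodule_and_deriv_eq (E := E) (𝔪 := 𝔪) (y := y) (v := v) h

theorem hasDerivAt_modelVec_of_differentiableAt {y : ℝ → 𝔪} {t : ℝ}
    (h : DifferentiableAt ℝ y t) :
    HasDerivAt (fun s ↦ modelVec (y s)) (modelVec (deriv y t)) t :=
  hasDerivAt_submodule_of_differentiableAt (E := E) (𝔪 := 𝔪) (y := y) h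

end ModelVec

/-! ### Lifted curves in charts, and the algebraic equation for the spray vector. -/

section Lift

variable {E F G K : Type*} [NormedAddCommGroup E] [NormedSpace ℝ E]
  [NormedAddCommGroup F] [NormedSpace ℝ F] [NormedAddCommGroup K] [NormedSpace ℝ K]
  [Group G] [TopologicalSpace G] [ChartedSpace E G]
  {H : Subgroup G} [ChartedSpace F (G ⧸ H)]
  {𝔪 : Submodule ℝ (GroupLieAlgebra 𝓘(ℝ, E) G)}
  {c : ℝ → G ⧸ H} {cbar : ℝ → G} {y : ℝ → 𝔪} {J : Set ℝ}

theorem IsLiftOn.smul_eq (hl : IsLiftOn c cbar y J) (g : G) {t : ℝ} (ht : t ∈ J) :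
    g • c t = ((g * cbar t : G) : G ⧸ H) := by
  rw [hl.eq_smul t ht]
  exact congrArg (fun a : G ↦ ((g * a : G) : G ⧸ H)) (mul_one (cbar t))

theorem IsLiftOn.mdifferentiableAt (hl : IsLiftOn c cbar y J) (hJ : IsOpen J) {t : ℝ} (ht : t ∈ J) :
    MDifferentiableAt 𝓘(ℝ, ℝ) 𝓘(ℝ, E) cbar t :=
  (hl.contMDiffOn.contMDiffAt (hJ.mem_nhds ht)).mdifferentiableAt (by simp)

variable [LieGroup 𝓘(ℝ, E) ∞ G]

/-- Left translation does not change the left invariant velocity `y`. The extra factor `g` is what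
later turns a geodesic through `o` into an equation at an arbitrary point of `G`. -/
theorem IsLiftOn.hasDerivAt_comp (hl : IsLiftOn c cbar y J) (hJ : IsOpen J) {t : ℝ} (ht : t ∈ J)
    {f : G → K} (g : G) (hf : MDifferentiableAt 𝓘(ℝ, E) 𝓘(ℝ, K) f (g * cbar t)) :
    HasDerivAt (fun s ↦ f (g * cbar s)) (leftDeriv E f (g * cbar t) (modelVec (y t))) t := by
  have h1 : MDifferentiableAt 𝓘(ℝ, E) 𝓘(ℝ, K) (fun a ↦ f (g * a)) (cbar t) :=
    hf.comp (cbar t) ((contMDiff_mul_left (I := 𝓘(ℝ, E)) (n := ∞) (a := g)).mdifferentiable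
      (by simp) _)
  have h2 := hasDerivAt_comp_of_velocity_eq (hl.mdifferentiableAt hJ ht) (hl.velocity_eq t ht) h1
  rw [leftDeriv_comp_mul_left] at h2
  exact h2

variable {e : OpenPartialHomeomorph (G ⧸ H) F}

theorem IsLiftOn.mdifferentiableAt_smul
    (hπ : Manifold.IsSubmersion 𝓘(ℝ, E) 𝓘(ℝ, F) ∞ (fun a : G ↦ (a : G ⧸ H)))
    (hl : IsLiftOn c cbar y J) (hJ : IsOpen J) {t : ℝ} (ht : t ∈ J) (g : G) :
    MDifferentiableAt 𝓘(ℝ, ℝ) 𝓘(ℝ, F) (fun s ↦ g • c s) t := by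
  have h1 : MDifferentiableAt 𝓘(ℝ, ℝ) 𝓘(ℝ, F) (fun s ↦ ((g * cbar s : G) : G ⧸ H)) t :=
    (hπ.contMDiff.mdifferentiable (by simp) (g * cbar t)).comp t
      (((contMDiff_mul_left (I := 𝓘(ℝ, E)) (n := ∞) (a := g)).mdifferentiable
        (by simp) _).comp t (hl.mdifferentiableAt hJ ht))
  refine h1.congr_of_eventuallyEq ?_
  filter_upwards [hJ.mem_nhds ht] with s hs using hl.smul_eq g hs

theorem IsLiftOn.hasDerivAt_leftDeriv
    (hπ : Manifold.IsSubmersion 𝓘(ℝ, E) 𝓘(ℝ, F) ∞ (fun a : G ↦ (a : G ⧸ H)))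
    (he : e ∈ IsManifold.maximalAtlas 𝓘(ℝ, F) ∞ (G ⧸ H))
    (hl : IsLiftOn c cbar y J) (hJ : IsOpen J) {t : ℝ} (ht : t ∈ J) (g : G)
    (hg : ((g * cbar t : G) : G ⧸ H) ∈ e.source) :
    HasDerivAt (fun s ↦ leftDeriv E (projCoord H e) (g * cbar s))
      (leftDeriv E (leftDeriv E (projCoord H e)) (g * cbar t) (modelVec (y t))) t :=
  hl.hasDerivAt_comp hJ ht g
    ((contMDiffAt_leftDeriv (contMDiffAt_projCoord hπ he hg)).mdifferentiableAt (by simp))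

theorem IsLiftOn.eventually_mul_mem_source
    (hπ : Manifold.IsSubmersion 𝓘(ℝ, E) 𝓘(ℝ, F) ∞ (fun a : G ↦ (a : G ⧸ H)))
    (hl : IsLiftOn c cbar y J) (hJ : IsOpen J) {t : ℝ} (ht : t ∈ J) (g : G)
    (hg : ((g * cbar t : G) : G ⧸ H) ∈ e.source) :
    ∀ᶠ s in 𝓝 t, ((g * cbar s : G) : G ⧸ H) ∈ e.source := by
  have : ContinuousMul G := (topologicalGroup_of_lieGroup 𝓘(ℝ, E) ∞).toContinuousMul
  have h1 : ContinuousAt (fun s ↦ ((g * cbar s : G) : G ⧸ H)) t :=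
    hπ.contMDiff.continuous.continuousAt.comp (f := fun s ↦ g * cbar s)
      (continuousAt_const.mul (hl.mdifferentiableAt hJ ht).continuousAt)
  exact h1.eventually_mem (e.open_source.mem_nhds hg)

/-- The velocity of the translate `g c` of a lifted curve, in a chart. -/
theorem IsLiftOn.tangentCoord_velocityLift_smul
    (hπ : Manifold.IsSubmersion 𝓘(ℝ, E) 𝓘(ℝ, F) ∞ (fun a : G ↦ (a : G ⧸ H)))
    (he : e ∈ IsManifold.maximalAtlas 𝓘(ℝ, F) ∞ (G ⧸ H))
    (hl : IsLiftOn c cbar y J) (hJ : IsOpen J) {t : ℝ} (ht : t ∈ J) (g : G)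
    (hg : ((g * cbar t : G) : G ⧸ H) ∈ e.source) :
    (tangentCoord e (velocityLift F (fun s ↦ g • c s) t)).2 =
      leftDeriv E (projCoord H e) (g * cbar t) (modelVec (y t)) := by
  have hg' : g • c t ∈ e.source := by rwa [hl.smul_eq g ht]
  have h1 := hasDerivAt_comp_velocity he (hl.mdifferentiableAt_smul hπ hJ ht g) hg'
  have h2 := hl.hasDerivAt_comp hJ ht g (mdifferentiableAt_projCoord hπ he hg)
  refine h1.unique (h2.congr_of_eventuallyEq ?_)
  filter_upwards [hJ.mem_nhds ht] with s hs using congrArg e (hl.smul_eq g hs)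

theorem IsLiftOn.tangentCoord_velocityLift
    (hπ : Manifold.IsSubmersion 𝓘(ℝ, E) 𝓘(ℝ, F) ∞ (fun a : G ↦ (a : G ⧸ H)))
    (he : e ∈ IsManifold.maximalAtlas 𝓘(ℝ, F) ∞ (G ⧸ H))
    (hl : IsLiftOn c cbar y J) (hJ : IsOpen J) {t : ℝ} (ht : t ∈ J)
    (hg : (cbar t : G ⧸ H) ∈ e.source) :
    (tangentCoord e (velocityLift F c t)).2 =
      leftDeriv E (projCoord H e) (cbar t) (modelVec (y t)) := by
  have := hl.tangentCoord_velocityLift_smul hπ he hJ ht 1 (by rwa [one_mul])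
  simpa only [one_smul, one_mul] using this

variable [IsManifold 𝓘(ℝ, F) ∞ (G ⧸ H)] [FiniteDimensional ℝ E] [FiniteDimensional ℝ F]

theorem leftDeriv_modelVec_eq_zero
    (hπ : Manifold.IsSubmersion 𝓘(ℝ, E) 𝓘(ℝ, F) ∞ (fun a : G ↦ (a : G ⧸ H)))
    (h𝔪 : IsCompl (subgroupLieAlgebra E H) 𝔪)
    (he : e ∈ IsManifold.maximalAtlas 𝓘(ℝ, F) ∞ (G ⧸ H)) {g : G} (hg : (g : G ⧸ H) ∈ e.source)
    {v : 𝔪} (hv : leftDeriv E (projCoord H e) g (modelVec v) = 0) : v = 0 := by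
  have h1 := (leftDeriv_projCoord_surjective_and_ker hπ he hg).2 v.1 hv
  exact Subtype.ext (Submodule.disjoint_def.1 h𝔪.disjoint v.1 h1 v.2)

theorem exists_frame_leftDeriv
    (hπ : Manifold.IsSubmersion 𝓘(ℝ, E) 𝓘(ℝ, F) ∞ (fun a : G ↦ (a : G ⧸ H)))
    (h𝔪 : IsCompl (subgroupLieAlgebra E H) 𝔪)
    (he : e ∈ IsManifold.maximalAtlas 𝓘(ℝ, F) ∞ (G ⧸ H)) {g : G} (hg : (g : G ⧸ H) ∈ e.source) :
    ∃ (j : F →L[ℝ] E) (k : F → 𝔪), (∀ u, modelVec (k u) = j u) ∧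
      (∀ u, leftDeriv E (projCoord H e) g (j u) = u) ∧
      ∀ v : 𝔪, k (leftDeriv E (projCoord H e) g (modelVec v)) = v :=
  exists_frame h𝔪 (leftDeriv_projCoord_surjective_and_ker hπ he hg).1 fun v ↦
    ⟨(leftDeriv_projCoord_surjective_and_ker hπ he hg).2 v,
      leftDeriv_projCoord_apply_eq_zero hπ he hg⟩

variable {S : Spray F (G ⧸ H)}

/-- The spray vector at `y₀` is determined, in any chart and at any point of `G`, by the equation of
geodesics. -/
theorem IsSprayVector.leftDeriv_eq
    (hπ : Manifold.IsSubmersion 𝓘(ℝ, E) 𝓘(ℝ, F) ∞ (fun a : G ↦ (a : G ⧸ H)))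
    (h𝔪 : IsCompl (subgroupLieAlgebra E H) 𝔪) (hS : S.IsInvariant G) {y₀ v : 𝔪}
    (hv : IsSprayVector S 𝔪 y₀ v)
    (he : e ∈ IsManifold.maximalAtlas 𝓘(ℝ, F) ∞ (G ⧸ H)) {g : G} (hg : (g : G ⧸ H) ∈ e.source) :
    leftDeriv E (projCoord H e) g (modelVec v) =
      (2 : ℝ) • S.coeff e (projCoord H e g) (leftDeriv E (projCoord H e) g (modelVec y₀)) +
        leftDeriv E (leftDeriv E (projCoord H e)) g (modelVec y₀) (modelVec y₀) := by
  obtain ⟨ε, c, cbar, y, hε, hc, hc0, hl, hy⟩ := hv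
  set J := Ioo (-ε) ε with hJdef
  have hJ : IsOpen J := isOpen_Ioo
  have h0 : (0 : ℝ) ∈ J := by simp [hJdef, hε]
  -- The initial velocity is known only in `T_o(G/H)`; injectivity of the differential of the
  -- projection on `𝔪` identifies `y 0`.
  have hy0 : y 0 = y₀ := by
    set e₁ := chartAt F ((1 : G) : G ⧸ H)
    have he₁ : e₁ ∈ IsManifold.maximalAtlas 𝓘(ℝ, F) ∞ (G ⧸ H) :=
      IsManifold.chart_mem_maximalAtlas _
    have h1 : ((1 : G) : G ⧸ H) ∈ e₁.source := mem_chart_source F _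
    have h2 := hl.tangentCoord_velocityLift hπ he₁ hJ h0 (by rwa [hl.map_zero])
    rw [hl.map_zero, hc0] at h2
    have h3 : leftDeriv E (projCoord H e₁) 1 (modelVec y₀) =
        leftDeriv E (projCoord H e₁) 1 (modelVec (y 0)) :=
      (tangentCoord_cosetPush_snd hπ he₁ h1 y₀.1).symm.trans h2
    refine sub_eq_zero.1 (leftDeriv_modelVec_eq_zero hπ h𝔪 he₁ h1 ?_)
    rw [modelVec_sub, map_sub, h3, sub_self]
  have hg0 : ((g * cbar 0 : G) : G ⧸ H) ∈ e.source := by rwa [hl.map_zero, mul_one]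
  have hgc0 : g • c 0 ∈ e.source := by rwa [hl.smul_eq g h0]
  -- By invariance the translate `g c`, which passes through `g · o` at time `0`, is also tangent to
  -- the spray there.
  have h1 := S.hasMFDerivAt_velocityLift_comp (contMDiff_coset_smul hπ g) (hS g) (c := c) (t := 0)
    (by
      filter_upwards [hJ.mem_nhds h0] with s hs
      exact (hc.contMDiffOn.contMDiffAt (hJ.mem_nhds hs)).mdifferentiableAt (by simp))
    (hc.velocity_ne_zero 0 h0)
    ((hc.isMIntegralCurveOn 0 h0).hasMFDerivAt (hJ.mem_nhds h0))
  have h2 := hl.tangentCoord_velocityLift_smul hπ he hJ h0 g hg0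
  have hne : velocity (F := F) (fun s ↦ g • c s) 0 ≠ 0 := by
    intro h
    have h3 : (velocityLift F (fun s ↦ g • c s) 0).snd = 0 := h
    rw [← tangentCoord_snd_eq_zero_iff he hgc0, h2] at h3
    exact hl.ne_zero 0 h0 (leftDeriv_modelVec_eq_zero hπ h𝔪 he hg0 h3)
  have h3 := S.hasDerivAt_tangentCoord_velocityLift he hgc0 hne h1
  -- Product rule for the coordinate velocity, the left derivative at `g * cbar s` applied to `y s`;
  -- comparison with the geodesic equation gives the formula.
  have h4 := (hl.hasDerivAt_leftDeriv hπ he hJ h0 g hg0).clm_apply (hasDerivAt_iff_modelVec.1 hy)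
  have h5 := h3.unique (h4.congr_of_eventuallyEq (by
    filter_upwards [hJ.mem_nhds h0, hl.eventually_mul_mem_source hπ hJ h0 g hg0] with s hs hs'
    exact hl.tangentCoord_velocityLift_smul hπ he hJ hs g hs'))
  have h6 : e (g • c 0) = projCoord H e g := by
    rw [hl.smul_eq g h0, hl.map_zero, mul_one]; rfl
  rw [h2, h6, hl.map_zero, mul_one, hy0, modelVec_neg, map_neg, neg_smul] at h5
  rw [← sub_eq_zero] at h5 ⊢
  rw [← h5]
  abel

end Lift

/-! ### The ODE for lifts of geodesics. -/

section GeodesicField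

variable {E F G : Type*} [NormedAddCommGroup E] [NormedSpace ℝ E]
  [NormedAddCommGroup F] [NormedSpace ℝ F]
  [Group G] [TopologicalSpace G] [ChartedSpace E G]
  {H : Subgroup G} [ChartedSpace F (G ⧸ H)] [IsManifold 𝓘(ℝ, F) ∞ (G ⧸ H)]
  {𝔪 : Submodule ℝ (GroupLieAlgebra 𝓘(ℝ, E) G)}

/-- The vector field whose integral curves `(x, z)` describe, in the chart of `G` at `1`, the lifts
of the geodesics of a spray on `G/H` and their left-invariant velocities `j z`. -/
noncomputable def geodesicField (S : Spray F (G ⧸ H)) (e : OpenPartialHomeomorph (G ⧸ H) F)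
    (j : F →L[ℝ] E) (p : E × F) : E × F :=
  let g : G := (chartAt E (1 : G)).symm p.1
  (leftDeriv E (chartAt E (1 : G)) g (j p.2),
    -((leftDeriv E (projCoord H e) g).comp j).inverse
      ((2 : ℝ) • S.coeff e (projCoord H e g) (leftDeriv E (projCoord H e) g (j p.2)) +
        leftDeriv E (leftDeriv E (projCoord H e)) g (j p.2) (j p.2)))

variable [LieGroup 𝓘(ℝ, E) ∞ G]

theorem contDiffAt_comp_chartAt_symm {K : Type*} [NormedAddCommGroup K] [NormedSpace ℝ K]
    {f : G → K} {x : E} (hx : x ∈ (chartAt E (1 : G)).target)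
    (hf : ContMDiffAt 𝓘(ℝ, E) 𝓘(ℝ, K) ∞ f ((chartAt E (1 : G)).symm x)) :
    ContDiffAt ℝ ∞ (fun x ↦ f ((chartAt E (1 : G)).symm x)) x :=
  (hf.comp x (contMDiffAt_symm_of_mem_maximalAtlas
    (IsManifold.chart_mem_maximalAtlas 1) hx)).contDiffAt

variable [CompleteSpace F] {S : Spray F (G ⧸ H)} {e : OpenPartialHomeomorph (G ⧸ H) F}
  {j : F →L[ℝ] E}

theorem contDiffAt_geodesicField
    (hπ : Manifold.IsSubmersion 𝓘(ℝ, E) 𝓘(ℝ, F) ∞ (fun a : G ↦ (a : G ⧸ H)))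
    (he : e ∈ IsManifold.maximalAtlas 𝓘(ℝ, F) ∞ (G ⧸ H)) {p : E × F}
    (hp : p.1 ∈ (chartAt E (1 : G)).target)
    (hp' : (((chartAt E (1 : G)).symm p.1 : G) : G ⧸ H) ∈ e.source) (hz : p.2 ≠ 0)
    (hinv : ((leftDeriv E (projCoord H e) ((chartAt E (1 : G)).symm p.1)).comp j).IsInvertible) :
    ContDiffAt ℝ ∞ (geodesicField S e j) p := by
  set κ := chartAt E (1 : G) with hκ
  have hf := contMDiffAt_projCoord hπ he hp'
  have h1 : ContDiffAt ℝ ∞ (fun q : E × F ↦ projCoord H e (κ.symm q.1)) p :=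
    (contDiffAt_comp_chartAt_symm hp hf).comp p contDiffAt_fst
  have h2 : ContDiffAt ℝ ∞ (fun q : E × F ↦ leftDeriv E (projCoord H e) (κ.symm q.1)) p :=
    (contDiffAt_comp_chartAt_symm hp (contMDiffAt_leftDeriv hf)).comp p contDiffAt_fst
  have h3 : ContDiffAt ℝ ∞
      (fun q : E × F ↦ leftDeriv E (leftDeriv E (projCoord H e)) (κ.symm q.1)) p :=
    (contDiffAt_comp_chartAt_symm hp (contMDiffAt_leftDeriv (contMDiffAt_leftDeriv hf))).comp p
      contDiffAt_fst
  have h4 : ContDiffAt ℝ ∞ (fun q : E × F ↦ leftDeriv E κ (κ.symm q.1)) p :=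
    (contDiffAt_comp_chartAt_symm hp (contMDiffAt_leftDeriv (contMDiffAt_of_mem_maximalAtlas
      (IsManifold.chart_mem_maximalAtlas 1) (κ.map_target hp)))).comp p contDiffAt_fst
  have h5 : ContDiffAt ℝ ∞ (fun q : E × F ↦ j q.2) p := j.contDiff.contDiffAt.comp p contDiffAt_snd
  have h6 : ContDiffAt ℝ ∞
      (fun q : E × F ↦ ((leftDeriv E (projCoord H e) (κ.symm q.1)).comp j).inverse) p :=
    ContDiffAt.comp p (g := ContinuousLinearMap.inverse)
      (f := fun q : E × F ↦ (leftDeriv E (projCoord H e) (κ.symm q.1)).comp j)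
      hinv.contDiffAt_map_inverse (h2.clm_comp contDiffAt_const)
  -- The spray coefficients are known to be smooth only away from the zero section.
  have hne : leftDeriv E (projCoord H e) (κ.symm p.1) (j p.2) ≠ 0 := by
    intro h0
    obtain ⟨Q, hQ⟩ := hinv
    have : Q p.2 = 0 := (congrArg (fun L : F →L[ℝ] F ↦ L p.2) hQ).trans h0
    exact hz ((map_eq_zero_iff Q Q.injective).1 this)
  have h7 : ContDiffAt ℝ ∞ (fun q : E × F ↦ S.coeff e (projCoord H e (κ.symm q.1))
      (leftDeriv E (projCoord H e) (κ.symm q.1) (j q.2))) p :=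
    ContDiffAt.comp p (g := fun q : F × F ↦ S.coeff e q.1 q.2)
      (f := fun q : E × F ↦ (projCoord H e (κ.symm q.1),
        leftDeriv E (projCoord H e) (κ.symm q.1) (j q.2)))
      (S.contDiffAt_coeff he (e.map_source hp') hne) (h1.prodMk (h2.clm_apply h5))
  exact (h4.clm_apply h5).prodMk (h6.clm_apply
    ((contDiffAt_const.smul h7).add ((h3.clm_apply h5).clm_apply h5))).neg

end GeodesicField

/-! ### Existence of geodesics with lifts, hence of spray vectors. -/

section Existence

variable {E F G : Type*} [NormedAddCommGroup E] [NormedSpace ℝ E] [FiniteDimensional ℝ E]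
  [NormedAddCommGroup F] [NormedSpace ℝ F] [FiniteDimensional ℝ F]
  [Group G] [TopologicalSpace G] [ChartedSpace E G] [LieGroup 𝓘(ℝ, E) ∞ G]
  {H : Subgroup G} [ChartedSpace F (G ⧸ H)] [IsManifold 𝓘(ℝ, F) ∞ (G ⧸ H)]
  {𝔪 : Submodule ℝ (GroupLieAlgebra 𝓘(ℝ, E) G)} {S : Spray F (G ⧸ H)}

/-- Every nonzero `y₀ ∈ 𝔪` has a spray vector: the geodesic with initial velocity `y₀` and its lift
exist. -/
theorem exists_isSprayVector
    (hπ : Manifold.IsSubmersion 𝓘(ℝ, E) 𝓘(ℝ, F) ∞ (fun a : G ↦ (a : G ⧸ H)))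
    (h𝔪 : IsCompl (subgroupLieAlgebra E H) 𝔪) {y₀ : 𝔪} (hy₀ : y₀ ≠ 0) :
    ∃ v, IsSprayVector S 𝔪 y₀ v := by
  have : CompleteSpace F := FiniteDimensional.complete ℝ F
  have : CompleteSpace E := FiniteDimensional.complete ℝ E
  set κ := chartAt E (1 : G) with hκ
  have hκm : κ ∈ IsManifold.maximalAtlas 𝓘(ℝ, E) ∞ G := IsManifold.chart_mem_maximalAtlas _
  set e := chartAt F ((1 : G) : G ⧸ H) with he_def
  have he : e ∈ IsManifold.maximalAtlas 𝓘(ℝ, F) ∞ (G ⧸ H) := IsManifold.chart_mem_maximalAtlas _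
  have h1e : ((1 : G) : G ⧸ H) ∈ e.source := mem_chart_source F _
  have h1κ : (1 : G) ∈ κ.source := mem_chart_source E _
  obtain ⟨j, k, hk, hj, hkj⟩ := exists_frame_leftDeriv hπ h𝔪 he h1e
  set f := projCoord H e with hf_def
  have hkz : ∀ z, k z = 0 → z = 0 := by
    intro z hz
    rw [← hj z, ← hk z, hz, modelVec_zero, map_zero]
  have hB : ∀ g : G, (g : G ⧸ H) ∈ e.source → ∀ z, leftDeriv E f g (j z) = 0 → z = 0 := by
    intro g hg z hz
    rw [← hk z] at hz
    exact hkz z (leftDeriv_modelVec_eq_zero hπ h𝔪 he hg hz)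
  -- The frame `j` is adapted to `g = 1`, but it takes values in `𝔪`, on which the left derivative
  -- is injective at every `g`; injective endomorphisms of `F` are invertible.
  have hinv : ∀ g : G, (g : G ⧸ H) ∈ e.source → ((leftDeriv E f g).comp j).IsInvertible := by
    intro g hg
    have hinj : Function.Injective ((leftDeriv E f g).comp j).toLinearMap :=
      (injective_iff_map_eq_zero _).2 (hB g hg)
    exact ⟨(LinearEquiv.ofInjectiveEndo _ hinj).toContinuousLinearEquiv, by ext; rfl⟩
  set Ω : Set (E × F) := {p | (p.1 ∈ κ.target ∧ ((κ.symm p.1 : G) : G ⧸ H) ∈ e.source) ∧ p.2 ≠ 0}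
    with hΩ_def
  have hΩ : IsOpen Ω := by
    have h1 : IsOpen (κ.target ∩ κ.symm ⁻¹' {g : G | (g : G ⧸ H) ∈ e.source}) :=
      κ.isOpen_inter_preimage_symm (e.open_source.preimage hπ.contMDiff.continuous)
    exact (h1.preimage continuous_fst).inter (isOpen_ne.preimage continuous_snd)
  have hΦ : ∀ p ∈ Ω, ContDiffAt ℝ ∞ (geodesicField S e j) p := fun p hp ↦
    contDiffAt_geodesicField hπ he hp.1.1 hp.1.2 hp.2 (hinv _ hp.1.2)
  set z₀ : F := leftDeriv E f 1 (modelVec y₀) with hz₀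
  have hz₀' : z₀ ≠ 0 := fun h ↦ hy₀ (leftDeriv_modelVec_eq_zero hπ h𝔪 he h1e h)
  have hp₀ : ((κ 1, z₀) : E × F) ∈ Ω :=
    ⟨⟨κ.map_source h1κ, by rw [κ.left_inv h1κ]; exact h1e⟩, hz₀'⟩
  have hΦ₁ : ContDiffAt ℝ 1 (geodesicField S e j) (κ 1, z₀) := (hΦ _ hp₀).of_le (by norm_cast)
  obtain ⟨α, hα0, δ, hδ, hα⟩ :
      ∃ α : ℝ → E × F, α 0 = (κ 1, z₀) ∧ ∃ δ > 0, ∀ t ∈ Ioo (0 - δ) (0 + δ),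
        HasDerivAt α (geodesicField S e j (α t)) t :=
    hΦ₁.exists_forall_mem_closedBall_exists_eq_forall_mem_Ioo_hasDerivAt₀ 0
  rw [zero_sub, zero_add] at hα
  -- Shrinks the interval so that the solution stays where the field is smooth, the charts apply and
  -- the velocity is nonzero.
  have hev : ∀ᶠ t in 𝓝 (0 : ℝ), α t ∈ Ω ∧ t ∈ Ioo (-δ) δ := by
    have h0 : (0 : ℝ) ∈ Ioo (-δ) δ := by simp [hδ]
    refine ((hα 0 h0).continuousAt.eventually_mem (hΩ.mem_nhds (by rwa [hα0]))).and ?_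
    exact isOpen_Ioo.mem_nhds h0
  obtain ⟨ε, hε, hball⟩ := Metric.eventually_nhds_iff.1 hev
  set J := Ioo (-ε) ε with hJ_def
  have hJ : IsOpen J := isOpen_Ioo
  have h0J : (0 : ℝ) ∈ J := by simp [hJ_def, hε]
  have hJb : ∀ t ∈ J, α t ∈ Ω ∧ t ∈ Ioo (-δ) δ := fun t ht ↦
    hball (by rw [Real.dist_eq, sub_zero]; exact abs_lt.2 ht)
  have hαd : ∀ t ∈ J, HasDerivAt α (geodesicField S e j (α t)) t := fun t ht ↦ hα t (hJb t ht).2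
  have hαs : ContDiffOn ℝ ∞ α J :=
    contDiffOn_of_hasDerivAt_comp hJ hαd fun t ht ↦ hΦ _ (hJb t ht).1
  set cbar : ℝ → G := fun t ↦ κ.symm (α t).1 with hcbar
  have hcs : ContMDiffOn 𝓘(ℝ, ℝ) 𝓘(ℝ, E) ∞ cbar J := fun t ht ↦
    ContMDiffAt.comp_contMDiffWithinAt t (g := κ.symm) (f := fun t ↦ (α t).1)
      (contMDiffAt_symm_of_mem_maximalAtlas hκm (hJb t ht).1.1.1) (hαs.fst t ht).contMDiffWithinAt
  have hcd : ∀ t ∈ J, MDifferentiableAt 𝓘(ℝ, ℝ) 𝓘(ℝ, E) cbar t := fun t ht ↦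
    (hcs.contMDiffAt (hJ.mem_nhds ht)).mdifferentiableAt (by simp)
  have hcb0 : cbar 0 = 1 := by simp only [hcbar, hα0, κ.left_inv h1κ]
  set y : ℝ → 𝔪 := fun t ↦ k (α t).2 with hy_def
  have hmy : ∀ t, modelVec (y t) = j (α t).2 := fun t ↦ hk _
  set c : ℝ → G ⧸ H := fun t ↦ (cbar t : G ⧸ H) with hc_def
  have hl : IsLiftOn c cbar y J := by
    refine ⟨hcs, hcb0, fun t ht ↦ congrArg (fun a : G ↦ (a : G ⧸ H)) (mul_one _).symm,
      fun t ht ↦ ?_, fun t ht h0 ↦ (hJb t ht).1.2 (hkz _ h0)⟩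
    have hct : cbar t ∈ κ.source := κ.map_target (hJb t ht).1.1.1
    refine (mdifferentiable_of_mem_maximalAtlas hκm).mfderiv_injective hct ?_
    refine Eq.trans ?_ (mfderiv_mulInvariantVectorField
      ((mdifferentiable_of_mem_maximalAtlas hκm).mdifferentiableAt hct) (y t).1).symm
    have h2 := hasDerivAt_comp_velocity hκm (hcd t ht) hct
    have h3 : HasDerivAt (fun s ↦ κ (cbar s)) (geodesicField S e j (α t)).1 t := by
      have h4 : HasDerivAt (fun s ↦ (α s).1) (geodesicField S e j (α t)).1 t := (hαd t ht).fst
      refine HasDerivAt.congr_of_eventuallyEq h4 ?_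
      filter_upwards [hJ.mem_nhds ht] with s hs using κ.right_inv (hJb s hs).1.1.1
    refine (h2.unique h3).trans ?_
    exact congrArg (leftDeriv E κ (cbar t)) (hmy t).symm
  have hce : ∀ t ∈ J, c t ∈ e.source := fun t ht ↦ (hJb t ht).1.1.2
  have hvel : ∀ t ∈ J, (tangentCoord e (velocityLift F c t)).2 = leftDeriv E f (cbar t) (j (α t).2) :=
    fun t ht ↦ by rw [hl.tangentCoord_velocityLift hπ he hJ ht (hce t ht), hmy]
  have hvne : ∀ t ∈ J, leftDeriv E f (cbar t) (j (α t).2) ≠ 0 := fun t ht h0 ↦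
    (hJb t ht).1.2 (hB _ (hce t ht) _ h0)
  have hcsm : ContMDiffOn 𝓘(ℝ, ℝ) 𝓘(ℝ, F) ∞ c J := hπ.contMDiff.comp_contMDiffOn hcs
  have hgeo : S.IsGeodesicOn c J := by
    refine ⟨hcsm, fun t ht h0 ↦ ?_, fun t ht ↦ HasMFDerivAt.hasMFDerivWithinAt ?_⟩
    · exact hvne t ht ((hvel t ht).symm.trans ((tangentCoord_snd_eq_zero_iff he (hce t ht)
        (p := velocityLift F c t)).2 h0))
    · set q : ℝ → F × F := fun s ↦ (f (cbar s), leftDeriv E f (cbar s) (j (α s).2)) with hq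
      have hqv : ∀ s ∈ J, tangentOfCoord e (q s) = velocityLift F c s := by
        intro s hs
        rw [← tangentOfCoord_tangentCoord he (p := velocityLift F c s) (hce s hs)]
        exact congrArg _ (Prod.ext rfl (hvel s hs).symm)
      have h1 : HasDerivAt (fun s ↦ f (cbar s)) (leftDeriv E f (cbar t) (j (α t).2)) t := by
        have := hl.hasDerivAt_comp hJ ht (f := f) 1 (by
          rw [one_mul]; exact mdifferentiableAt_projCoord hπ he (hce t ht))
        simpa only [one_mul, hmy] using this
      have h2 : HasDerivAt (fun s ↦ leftDeriv E f (cbar s))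
          (leftDeriv E (leftDeriv E f) (cbar t) (j (α t).2)) t := by
        have := hl.hasDerivAt_leftDeriv hπ he hJ ht 1 (by rw [one_mul]; exact hce t ht)
        simpa only [one_mul, hmy] using this
      have h3 : HasDerivAt (fun s ↦ j (α s).2) (j (geodesicField S e j (α t)).2) t :=
        j.hasFDerivAt.comp_hasDerivAt t (hαd t ht).snd
      have h4 := h1.prodMk (h2.clm_apply h3)
      -- The inverse in the second component of `geodesicField` cancels here, leaving the
      -- acceleration demanded by the geodesic equation.
      have h5 : leftDeriv E f (cbar t) (j (geodesicField S e j (α t)).2) =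
          -((2 : ℝ) • S.coeff e (f (cbar t)) (leftDeriv E f (cbar t) (j (α t).2)) +
            leftDeriv E (leftDeriv E f) (cbar t) (j (α t).2) (j (α t).2)) := by
        have h6 := (hinv _ (hce t ht)).self_comp_inverse
        have h7 := fun u ↦ congrArg (fun L : F →L[ℝ] F ↦ L u) h6
        simp only [ContinuousLinearMap.comp_apply, ContinuousLinearMap.id_apply] at h7
        simp only [geodesicField, map_neg]
        exact congrArg Neg.neg (h7 _)
      have h8 : vectorFieldCoord S.toFun e (q t) = (leftDeriv E f (cbar t) (j (α t).2),
          leftDeriv E (leftDeriv E f) (cbar t) (j (α t).2) (j (α t).2) +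
            leftDeriv E f (cbar t) (j (geodesicField S e j (α t)).2)) := by
        have hvf := S.vectorFieldCoord_eq he (x := f (cbar t)) (e.map_source (hce t ht))
          (hvne t ht)
        refine hvf.trans (Prod.ext rfl ?_)
        rw [h5, neg_add_rev, add_neg_cancel_left, neg_smul]
      rw [← h8] at h4
      have h9 := hasMFDerivAt_tangentOfCoord_comp (M := G ⧸ H) he h4 (e.map_source (hce t ht))
      have h10 := h9.congr_of_eventuallyEq (f₁ := velocityLift F c) (by
        filter_upwards [hJ.mem_nhds ht] with s hs using (hqv s hs).symm)
      have key : ∀ p : TangentBundle 𝓘(ℝ, F) (G ⧸ H), p = velocityLift F c t →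
          (S.toFun p : F × F) = S.toFun (velocityLift F c t) := by rintro _ rfl; rfl
      refine h10.congr_mfderiv ?_
      exact congrArg (fun u : F × F ↦ (1 : ℝ →L[ℝ] ℝ).smulRight u) (key _ (hqv t ht))
  -- With `y = k z` for the second component `z` of `α`, the spray vector `-y'(0)` is `k (-z'(0))`.
  refine ⟨k (-(geodesicField S e j (α 0)).2), ε, c, cbar, y, hε, hgeo, ?_, hl, ?_⟩
  · have hc0 : c 0 = ((1 : G) : G ⧸ H) := by rw [hc_def]; simp only [hcb0]
    have hpr := cosetPush_proj (F := F) (H := H) (1 : G) y₀.1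
    refine tangentCoord_injOn he (hce 0 h0J) (show _ ∈ e.source by rw [hpr]; exact h1e) ?_
    refine Prod.ext ((congrArg e hc0).trans (congrArg e hpr).symm) ?_
    rw [hvel 0 h0J, hcb0, hα0]
    exact (hj z₀).trans (tangentCoord_cosetPush_snd hπ he h1e y₀.1).symm
  · refine hasDerivAt_iff_modelVec.2 ?_
    simp only [hmy]
    rw [modelVec_neg, hk, map_neg, neg_neg]
    exact j.hasFDerivAt.comp_hasDerivAt 0 (hαd 0 h0J).snd

end Existence

/-! ### The connection operator in coordinates. -/

section Connection

variable {E F G : Type*} [NormedAddCommGroup E] [NormedSpace ℝ E]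
  [NormedAddCommGroup F] [NormedSpace ℝ F]
  [Group G] [TopologicalSpace G] [ChartedSpace E G] [LieGroup 𝓘(ℝ, E) ∞ G]
  {H : Subgroup G} [ChartedSpace F (G ⧸ H)] [IsManifold 𝓘(ℝ, F) ∞ (G ⧸ H)]
  {𝔪 : Submodule ℝ (GroupLieAlgebra 𝓘(ℝ, E) G)} {S : Spray F (G ⧸ H)}
  {e : OpenPartialHomeomorph (G ⧸ H) F}

/-- The bracket and its `𝔪`-component differ by an element of `𝔥`, which the left derivative of the
projection kills; the rest is the commutator formula. -/
theorem leftDeriv_bracketProj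
    (hπ : Manifold.IsSubmersion 𝓘(ℝ, E) 𝓘(ℝ, F) ∞ (fun a : G ↦ (a : G ⧸ H)))
    (h𝔪 : IsCompl (subgroupLieAlgebra E H) 𝔪)
    (he : e ∈ IsManifold.maximalAtlas 𝓘(ℝ, F) ∞ (G ⧸ H)) {g : G} (hg : (g : G ⧸ H) ∈ e.source)
    (y w : 𝔪) :
    leftDeriv E (projCoord H e) g (modelVec (bracketProj h𝔪 y w)) =
      leftDeriv E (leftDeriv E (projCoord H e)) g (modelVec y) (modelVec w) -
        leftDeriv E (leftDeriv E (projCoord H e)) g (modelVec w) (modelVec y) := by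
  rw [leftDeriv_leftDeriv_sub (contMDiffAt_projCoord hπ he hg)]
  have h1 : ⁅(y : GroupLieAlgebra 𝓘(ℝ, E) G), (w : GroupLieAlgebra 𝓘(ℝ, E) G)⁆ -
      (bracketProj h𝔪 y w : GroupLieAlgebra 𝓘(ℝ, E) G) ∈ subgroupLieAlgebra E H := by
    refine (Submodule.projectionOnto_apply_eq_zero_iff h𝔪.symm).1 ?_
    rw [map_sub, Submodule.projectionOnto_apply_left, sub_eq_zero]
    rfl
  have h2 := leftDeriv_projCoord_apply_eq_zero hπ he hg h1
  exact (sub_eq_zero.1 ((map_sub (leftDeriv E (projCoord H e) g) _ _).symm.trans h2)).symm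

variable [FiniteDimensional ℝ E] [FiniteDimensional ℝ F]

/-- Existence makes the choice in `sprayVectorField` a genuine spray vector. -/
theorem isSprayVector_sprayVectorField
    (hπ : Manifold.IsSubmersion 𝓘(ℝ, E) 𝓘(ℝ, F) ∞ (fun a : G ↦ (a : G ⧸ H)))
    (h𝔪 : IsCompl (subgroupLieAlgebra E H) 𝔪) {y : 𝔪} (hy : y ≠ 0) :
    IsSprayVector S 𝔪 y (sprayVectorField S 𝔪 y) :=
  Classical.epsilon_spec (exists_isSprayVector hπ h𝔪 hy)

/-- The derivative of the spray vector field. -/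
theorem leftDeriv_deriv_sprayVectorField
    (hπ : Manifold.IsSubmersion 𝓘(ℝ, E) 𝓘(ℝ, F) ∞ (fun a : G ↦ (a : G ⧸ H)))
    (h𝔪 : IsCompl (subgroupLieAlgebra E H) 𝔪) (hS : S.IsInvariant G)
    (he : e ∈ IsManifold.maximalAtlas 𝓘(ℝ, F) ∞ (G ⧸ H)) {g : G} (hg : (g : G ⧸ H) ∈ e.source)
    {y : 𝔪} (hy : y ≠ 0) (w : 𝔪) :
    leftDeriv E (projCoord H e) g
        (modelVec (deriv (fun t : ℝ ↦ sprayVectorField S 𝔪 (y + t • w)) 0)) =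
      (2 : ℝ) • S.connCoeff e (projCoord H e g) (leftDeriv E (projCoord H e) g (modelVec y))
          (leftDeriv E (projCoord H e) g (modelVec w)) +
        (leftDeriv E (leftDeriv E (projCoord H e)) g (modelVec w) (modelVec y) +
          leftDeriv E (leftDeriv E (projCoord H e)) g (modelVec y) (modelVec w)) := by
  obtain ⟨j, k, hk, hj, hkj⟩ := exists_frame_leftDeriv hπ h𝔪 he hg
  set A := leftDeriv E (projCoord H e) g with hA
  set B := leftDeriv E (leftDeriv E (projCoord H e)) g with hB
  have hAy : A (modelVec y) ≠ 0 := fun h ↦ hy (leftDeriv_modelVec_eq_zero hπ h𝔪 he hg h)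
  have hm : HasDerivAt (fun t : ℝ ↦ modelVec y + t • modelVec w) (modelVec w) 0 := by
    simpa using ((hasDerivAt_id (0 : ℝ)).smul_const (modelVec w)).const_add (modelVec y)
  have hAm : HasDerivAt (fun t : ℝ ↦ A (modelVec y + t • modelVec w)) (A (modelVec w)) 0 :=
    A.hasFDerivAt.comp_hasDerivAt 0 hm
  have h0 : modelVec y + (0 : ℝ) • modelVec w = modelVec y := by rw [zero_smul, add_zero]
  have hc : HasDerivAt (fun t : ℝ ↦ S.coeff e (projCoord H e g) (A (modelVec y + t • modelVec w)))
      (S.connCoeff e (projCoord H e g) (A (modelVec y)) (A (modelVec w))) 0 := by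
    have := S.hasFDerivAt_coeff he (x := projCoord H e g) (e.map_source hg) hAy
    rw [← h0] at this
    have h := HasFDerivAt.comp_hasDerivAt (0 : ℝ) this hAm
    rwa [h0] at h
  have hBm : HasDerivAt (fun t : ℝ ↦ B (modelVec y + t • modelVec w)) (B (modelVec w)) 0 :=
    B.hasFDerivAt.comp_hasDerivAt 0 hm
  have hφ := (hc.const_smul (2 : ℝ)).add (hBm.clm_apply hm)
  rw [h0] at hφ
  -- The formula for the spray vector requires a nonzero argument; `y + t • w` is nonzero for small
  -- `t`, which suffices for the derivative at `0`.
  have hne : ∀ᶠ t in 𝓝 (0 : ℝ), A (modelVec y + t • modelVec w) ≠ 0 :=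
    hAm.continuousAt.eventually_ne (by rwa [h0])
  have hjφ := j.hasFDerivAt.comp_hasDerivAt (0 : ℝ) hφ
  have hd := (deriv_eq_of_modelVec (y := fun t : ℝ ↦ sprayVectorField S 𝔪 (y + t • w)) (t := 0)
    (v := k _) (by
      rw [hk]
      refine hjφ.congr_of_eventuallyEq ?_
      filter_upwards [hne] with t ht
      have hyt : y + t • w ≠ 0 := fun h ↦ ht (by
        rw [← modelVec_smul, ← modelVec_add, h, modelVec_zero, map_zero])
      have h1 := (isSprayVector_sprayVectorField (S := S) hπ h𝔪 hyt).leftDeriv_eq hπ h𝔪 hS he hg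
      rw [← hkj (sprayVectorField S 𝔪 (y + t • w)), hk, h1]
      rfl)).2
  rw [hd, hk, hj]

/-- The derivative of the spray vector field supplies half the symmetrized second left derivative;
the total bracket coefficient `-1/2 + 1 = 1/2` supplies half the antisymmetrized one. Only the order
`(y, w)` survives, exactly the term produced by differentiating a field along the lift. -/
theorem leftDeriv_connectionOperator_add
    (hπ : Manifold.IsSubmersion 𝓘(ℝ, E) 𝓘(ℝ, F) ∞ (fun a : G ↦ (a : G ⧸ H)))
    (h𝔪 : IsCompl (subgroupLieAlgebra E H) 𝔪) (hS : S.IsInvariant G)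
    (he : e ∈ IsManifold.maximalAtlas 𝓘(ℝ, F) ∞ (G ⧸ H)) {g : G} (hg : (g : G ⧸ H) ∈ e.source)
    {y : 𝔪} (hy : y ≠ 0) (w : 𝔪) :
    leftDeriv E (projCoord H e) g
        (modelVec (connectionOperator S h𝔪 y w + bracketProj h𝔪 y w)) =
      S.connCoeff e (projCoord H e g) (leftDeriv E (projCoord H e) g (modelVec y))
          (leftDeriv E (projCoord H e) g (modelVec w)) +
        leftDeriv E (leftDeriv E (projCoord H e)) g (modelVec y) (modelVec w) := by
  rw [connectionOperator, modelVec_add, modelVec_sub, modelVec_smul, modelVec_smul, map_add,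
    map_sub, map_smul, map_smul, leftDeriv_deriv_sprayVectorField hπ h𝔪 hS he hg hy,
    leftDeriv_bracketProj hπ h𝔪 he hg]
  module

end Connection

/-! ### Vector fields along the lifted curve and their covariant derivatives. -/

section CovariantDerivative

variable {E F G : Type*} [NormedAddCommGroup E] [NormedSpace ℝ E]
  [NormedAddCommGroup F] [NormedSpace ℝ F]
  [Group G] [TopologicalSpace G] [ChartedSpace E G] [LieGroup 𝓘(ℝ, E) ∞ G]
  {H : Subgroup G} [ChartedSpace F (G ⧸ H)] [IsManifold 𝓘(ℝ, F) ∞ (G ⧸ H)]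
  {𝔪 : Submodule ℝ (GroupLieAlgebra 𝓘(ℝ, E) G)} {S : Spray F (G ⧸ H)}
  {e : OpenPartialHomeomorph (G ⧸ H) F}
  {J : Set ℝ} {c : ℝ → G ⧸ H} {cbar : ℝ → G} {y w : ℝ → 𝔪}
  {W : ℝ → TangentBundle 𝓘(ℝ, F) (G ⧸ H)}

theorem tangentCoord_field_eventuallyEq
    (hπ : Manifold.IsSubmersion 𝓘(ℝ, E) 𝓘(ℝ, F) ∞ (fun a : G ↦ (a : G ⧸ H)))
    (he : e ∈ IsManifold.maximalAtlas 𝓘(ℝ, F) ∞ (G ⧸ H))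
    (hl : IsLiftOn c cbar y J) (hJ : IsOpen J)
    (hw : ∀ t ∈ J, W t = cosetPush E F H (cbar t) (w t)) {t : ℝ} (ht : t ∈ J)
    (hg : (cbar t : G ⧸ H) ∈ e.source) :
    (fun s ↦ (tangentCoord e (W s)).2) =ᶠ[𝓝 t]
      fun s ↦ leftDeriv E (projCoord H e) (cbar s) (modelVec (w s)) := by
  have h := hl.eventually_mul_mem_source hπ hJ ht 1 (by rwa [one_mul])
  simp only [one_mul] at h
  filter_upwards [h, hJ.mem_nhds ht] with s hs hsJ
  rw [hw s hsJ]
  exact tangentCoord_cosetPush_snd hπ he hs (w s).1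

variable [FiniteDimensional ℝ E] [FiniteDimensional ℝ F]

/-- In the frame `j` taken at `cbar t`, the coordinates of `W s` are `B s` applied to those of `w
s`, where `B` is differentiable at `t` and `B t` is the identity. Inverting `B s` for `s` near `t`
expresses `w` through the smooth field `W`. -/
theorem differentiableAt_of_field
    (hπ : Manifold.IsSubmersion 𝓘(ℝ, E) 𝓘(ℝ, F) ∞ (fun a : G ↦ (a : G ⧸ H)))
    (h𝔪 : IsCompl (subgroupLieAlgebra E H) 𝔪)
    (hl : IsLiftOn c cbar y J) (hJ : IsOpen J) (hW : IsSmoothFieldAlongOn c W J)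
    (hw : ∀ t ∈ J, W t = cosetPush E F H (cbar t) (w t)) {t : ℝ} (ht : t ∈ J) :
    DifferentiableAt ℝ w t := by
  have : CompleteSpace F := FiniteDimensional.complete ℝ F
  set e := chartAt F (cbar t : G ⧸ H)
  have he : e ∈ IsManifold.maximalAtlas 𝓘(ℝ, F) ∞ (G ⧸ H) := IsManifold.chart_mem_maximalAtlas _
  have hg : (cbar t : G ⧸ H) ∈ e.source := mem_chart_source F _
  obtain ⟨j, k, hk, hj, hkj⟩ := exists_frame_leftDeriv hπ h𝔪 he hg
  have hWe : (W t).proj ∈ e.source := by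
    rw [hw t ht, cosetPush_proj]; exact hg
  have hWd : DifferentiableAt ℝ (fun s ↦ (tangentCoord e (W s)).2) t := by
    have h1 : MDifferentiableAt 𝓘(ℝ, ℝ) 𝓘(ℝ, F × F) (fun s ↦ tangentCoord e (W s)) t :=
      (mdifferentiableAt_tangentCoord he hWe).comp t
        ((hW.contMDiffOn.contMDiffAt (hJ.mem_nhds ht)).mdifferentiableAt (by simp))
    exact h1.differentiableAt.snd
  set B : ℝ → F →L[ℝ] F := fun s ↦ (leftDeriv E (projCoord H e) (cbar s)).comp j with hB
  have hBd : DifferentiableAt ℝ B t := by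
    have := hl.hasDerivAt_leftDeriv hπ he hJ ht 1 (by rwa [one_mul])
    simp only [one_mul] at this
    exact (this.clm_comp (hasDerivAt_const t j)).differentiableAt
  have hBt : B t = ContinuousLinearMap.id ℝ F := ContinuousLinearMap.ext hj
  have hinv : (B t).IsInvertible := ⟨ContinuousLinearEquiv.refl ℝ F, hBt.symm⟩
  have hBi : DifferentiableAt ℝ (fun s ↦ (B s).inverse) t :=
    ((hinv.contDiffAt_map_inverse (n := 1)).differentiableAt (by simp)).comp t hBd
  have hev : ∀ᶠ s in 𝓝 t, (B s).IsInvertible :=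
    hBd.continuousAt.eventually (hBt ▸ (ContinuousLinearEquiv.refl ℝ F).nhds)
  have h2 := j.hasFDerivAt.comp_hasDerivAt t (hBi.clm_apply hWd).hasDerivAt
  refine (deriv_eq_of_modelVec (y := w) (t := t) 
    (v := k (deriv (fun s ↦ (B s).inverse (tangentCoord e (W s)).2) t)) ?_).1
  rw [hk]
  refine h2.congr_of_eventuallyEq ?_
  filter_upwards [hev, tangentCoord_field_eventuallyEq hπ he hl hJ hw ht hg] with s hs hs'
  have h3 : modelVec (w s) = j (leftDeriv E (projCoord H e) (cbar t) (modelVec (w s))) := by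
    rw [← hk, hkj]
  have h4 : (tangentCoord e (W s)).2 =
      B s (leftDeriv E (projCoord H e) (cbar t) (modelVec (w s))) :=
    hs'.trans (congrArg (leftDeriv E (projCoord H e) (cbar s)) h3)
  have h5 : (B s).inverse (tangentCoord e (W s)).2 =
      leftDeriv E (projCoord H e) (cbar t) (modelVec (w s)) := hs.inverse_apply_eq.2 h4
  exact h3.trans (congrArg j h5.symm)

/-- The covariant derivative of `W` along `c` in a chart. -/
theorem hasDerivAt_tangentCoord_field
    (hπ : Manifold.IsSubmersion 𝓘(ℝ, E) 𝓘(ℝ, F) ∞ (fun a : G ↦ (a : G ⧸ H)))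
    (h𝔪 : IsCompl (subgroupLieAlgebra E H) 𝔪) (hS : S.IsInvariant G)
    (he : e ∈ IsManifold.maximalAtlas 𝓘(ℝ, F) ∞ (G ⧸ H))
    (hl : IsLiftOn c cbar y J) (hJ : IsOpen J)
    (hw : ∀ t ∈ J, W t = cosetPush E F H (cbar t) (w t)) {t : ℝ} (ht : t ∈ J)
    (hg : c t ∈ e.source) (hwd : DifferentiableAt ℝ w t) :
    ∃ dW : F, HasDerivAt (fun s ↦ (tangentCoord e (W s)).2) dW t ∧
      leftDeriv E (projCoord H e) (cbar t) (modelVec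
        (deriv w t + connectionOperator S h𝔪 (y t) (w t) + bracketProj h𝔪 (y t) (w t) : 𝔪)) = dW +
        S.connCoeff e (e (c t)) (tangentCoord e (velocityLift F c t)).2 (tangentCoord e (W t)).2 := by
  have hct : c t = (cbar t : G ⧸ H) := by simpa using hl.smul_eq 1 ht
  rw [hct] at hg
  have hfW := tangentCoord_field_eventuallyEq hπ he hl hJ hw ht hg
  have h1 := hl.hasDerivAt_leftDeriv hπ he hJ ht 1 (by rwa [one_mul])
  simp only [one_mul] at h1
  have h2 : HasDerivAt (fun s ↦ modelVec (w s)) (modelVec (deriv w t)) t :=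
    hasDerivAt_modelVec_of_differentiableAt hwd
  refine ⟨_, (h1.clm_apply h2).congr_of_eventuallyEq hfW, ?_⟩
  rw [add_assoc, modelVec_add, map_add,
    leftDeriv_connectionOperator_add hπ h𝔪 hS he hg (hl.ne_zero t ht), hfW.eq_of_nhds,
    hl.tangentCoord_velocityLift hπ he hJ ht hg, hct]
  simp only [projCoord]
  abel

end CovariantDerivative

end SprayGeometry

/-! ### The covariant derivative formula and the criterion for parallel fields. -/

open SprayGeometry in
theorem theorem6p1
    {E F G : Type*}
    [NormedAddCommGroup E] [NormedSpace ℝ E] [FiniteDimensional ℝ E]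
    [NormedAddCommGroup F] [NormedSpace ℝ F] [FiniteDimensional ℝ F]
    -- a Lie group `G` and a closed subgroup `H`
    [Group G] [TopologicalSpace G] [ChartedSpace E G] [LieGroup 𝓘(ℝ, E) ∞ G]
    (H : Subgroup G) (hH : IsClosed (H : Set G))
    -- the smooth coset space `G/H`, with the smooth structure making `G → G/H` a submersion
    [ChartedSpace F (G ⧸ H)] [IsManifold 𝓘(ℝ, F) ∞ (G ⧸ H)]
    (hπ : Manifold.IsSubmersion 𝓘(ℝ, E) 𝓘(ℝ, F) ∞ (fun a : G ↦ (a : G ⧸ H)))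
    -- a linear decomposition `𝔤 = 𝔥 + 𝔪`
    (𝔪 : Submodule ℝ (GroupLieAlgebra 𝓘(ℝ, E) G))
    (h𝔪 : IsCompl (subgroupLieAlgebra E H) 𝔪)
    -- a `G`-invariant spray on `G/H`
    (S : Spray F (G ⧸ H)) (hS : S.IsInvariant G)
    -- a curve `c` starting at `o`, and its lift `cbar`, over an open interval `J`
    (J : Set ℝ) (hJ : IsOpen J) (hJ' : J.OrdConnected) (hJ0 : (0 : ℝ) ∈ J)
    (c : ℝ → G ⧸ H) (hc : ContMDiffOn 𝓘(ℝ, ℝ) 𝓘(ℝ, F) ∞ c J)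
    (hc0 : c 0 = ((1 : G) : G ⧸ H))
    (hc' : ∀ t ∈ J, velocity (F := F) c t ≠ 0)
    (cbar : ℝ → G) (y : ℝ → 𝔪) (hcbar : IsLiftOn c cbar y J)
    -- a smooth vector field `W(t) = cbar(t)_* w(t)` along `c`
    (W : ℝ → TangentBundle 𝓘(ℝ, F) (G ⧸ H)) (hW : IsSmoothFieldAlongOn c W J)
    (w : ℝ → 𝔪) (hw : ∀ t ∈ J, W t = cosetPush E F H (cbar t) (w t)) :
    (∀ t ∈ J, DifferentiableAt ℝ w t ∧
      S.HasCovDerivAt c W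
        (cosetPush E F H (cbar t)
          (deriv w t + connectionOperator S h𝔪 (y t) (w t) + bracketProj h𝔪 (y t) (w t) : 𝔪)) t) ∧
    (S.IsLinearlyParallelOn c W J ↔
      ∀ t ∈ J, deriv w t + connectionOperator S h𝔪 (y t) (w t) + bracketProj h𝔪 (y t) (w t) = 0) := by

  have hcov : ∀ t ∈ J, DifferentiableAt ℝ w t ∧ S.HasCovDerivAt c W
      (cosetPush E F H (cbar t)
        (deriv w t + connectionOperator S h𝔪 (y t) (w t) + bracketProj h𝔪 (y t) (w t) : 𝔪)) t := by
    intro t ht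
    have hct : c t = (cbar t : G ⧸ H) := by simpa using hcbar.smul_eq 1 ht
    have hwd := differentiableAt_of_field hπ h𝔪 hcbar hJ hW hw ht
    refine ⟨hwd, (cosetPush_proj _ _).trans hct.symm, fun e he hg ↦ ?_⟩
    obtain ⟨dW, h1, h2⟩ := hasDerivAt_tangentCoord_field hπ h𝔪 hS he hcbar hJ hw ht hg hwd
    rw [hct] at hg
    exact ⟨dW, h1, (tangentCoord_cosetPush_snd hπ he hg _).trans h2⟩
  refine ⟨hcov, ⟨fun hp t ht ↦ ?_, fun h t ht ↦ ⟨rfl, fun e he hg ↦ ?_⟩⟩⟩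
  · set e := chartAt F (c t)
    have he : e ∈ IsManifold.maximalAtlas 𝓘(ℝ, F) ∞ (G ⧸ H) := IsManifold.chart_mem_maximalAtlas _
    have hg : c t ∈ e.source := mem_chart_source F _
    have hct : c t = (cbar t : G ⧸ H) := by simpa using hcbar.smul_eq 1 ht
    obtain ⟨dW, h1, h2⟩ :=
      hasDerivAt_tangentCoord_field hπ h𝔪 hS he hcbar hJ hw ht hg (hcov t ht).1
    obtain ⟨dW', h1', h2'⟩ := (hp t ht).2 e he hg
    -- Uniqueness of the derivative identifies the two coordinate expressions, so the left
    -- derivative of the projection vanishes on an element of `𝔪`, which is therefore zero.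
    rw [(tangentCoord_snd_eq_zero_iff he (p := ⟨c t, 0⟩) hg).2 rfl, h1'.unique h1, ← h2] at h2'
    exact leftDeriv_modelVec_eq_zero hπ h𝔪 he (hct ▸ hg) h2'.symm
  · obtain ⟨dW, h1, h2⟩ :=
      hasDerivAt_tangentCoord_field hπ h𝔪 hS he hcbar hJ hw ht hg (hcov t ht).1
    refine ⟨dW, h1, ?_⟩
    rw [(tangentCoord_snd_eq_zero_iff he (p := ⟨c t, 0⟩) hg).2 rfl, ← h2, h t ht, modelVec_zero,
      map_zero]
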